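/- Let $G$ be a finite group and $R$ a commutative unital ring. **Mackey functors.** Let $\Omega_R(G)$ be the $R$-linear category whose objects are the finite $G$-sets and whose morphisms $X\to Y$ form the $R$-module obtained by extension of scalars from the commutative monoid (under disjoint union) of isomorphism classes of spans $X\leftarrow V\to Y$ of finite $G$-sets; composition is given by pullback. For a $G$-map $f:X\to Y$ put $r_f=(X=X\xrightarrow{f}Y)$ and $t_f=(Y\xleftarrow{f}X=X)$. A Mackey functor is an $R$-linear functor $M:\Omega_R(G)^{op}\to R\text{-mod}$; morphisms are natural transformations. The Mackey algebra is $\mu_R(G)=\bigoplus_{H,K\le G}\hom_{\Omega_R(G)}(G/H,G/K)$ with multiplication given by composition ($ab$ is first $a$, then $b$; it is zero where $a$, $b$ are not composable). For $K\le H\le G$ and $g\in G$ let $R^H_K=r_{\pi}$ and $I^H_K=t_{\pi}$, where $\pi:G/K\to G/H$ is the projection, and $C_{g,H}=t_{c}$, where $c:G/H\to G/{}^gH$, $kH\mapsto kg^{-1}\,{}^gH$, and ${}^gH=gHg^{-1}$, $H^g=g^{-1}Hg$. These elements generate $\mu_R(G)$. For a Mackey functor $M$ let $\Phi M=\bigoplus_{H\le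 G}M(G/H)$, a left $\mu_R(G)$-module, so that $I^H_H\Phi M=M(G/H)$. **Dress pairings.** A Dress pairing $\theta$ from $M$ and $N$ to $P$ is a family of $R$-linear maps $\theta_X:M(X)\otimes_R N(X)\to P(X)$, one for each finite $G$-set $X$, such that for every $G$-map $f:X\to Y$ $$r_f\theta_Y(m\otimes n)=\theta_X(r_fm\otimes r_fn),\quad t_f\theta_X(m\otimes r_fn)=\theta_Y(t_fm\otimes n),\quad t_f\theta_X(r_fm\otimes n)=\theta_Y(m\otimes t_fn).$$ The set of these is denoted $\mathrm{Dress}(M,N;P)$. **Box product.** Let $M,N$ be left $\mu_R(G)$-modules. Define inductively $A_H=(I^H_HM\otimes_R I^H_HN)\oplus\bigoplus_{K<H}A_K$ for $H\le G$, and $A=\bigoplus_{H\le G}A_H$. Define operators $I^L_H$, $C_{g,H}$, $R^H_J$ on $A$ that map the grade $A_H$ to $A_L$, $A_{{}^gH}$, $A_J$ respectively and vanish on the other grades: $I^H_H$ is the identity of $A_H$, and for $H<L$ the operator $I^L_H$ is the inclusion of the summand $A_H$ of $A_L$; for $m\otimes n$ in the first summand of $A_H$ and $x\in A_K$, $K<H$,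 $$C_{g,H}(m\otimes n)=C_{g,H}m\otimes C_{g,H}n,\qquad C_{g,H}I^H_Kx=I^{{}^gH}_{{}^gK}C_{g,K}x,$$ $$R^H_J(m\otimes n)=R^H_Jm\otimes R^H_Jn,\qquad R^H_JI^H_Kx=\sum_{g\in[J\backslash H/K]}I^J_{{}^gK\cap J}C_gR^K_{K\cap J^g}x,$$ where $[J\backslash H/K]$ is a fixed set of representatives of the double cosets. Let $FR\subseteq A$ be the smallest $R$-submodule that is stable under all these operators and contains $a\otimes I^H_Kb-I^H_K(R^H_Ka\otimes b)$ and $I^H_Kc\otimes d-I^H_K(c\otimes R^H_Kd)$ for all $K<H$, $a\in I^H_HM$, $b\in I^K_KN$, $c\in I^K_KM$, $d\in I^H_HN$. Let $Rel\subseteq A$ be the $R$-span of all $p\cdot x$, where $x\in A$ and $p$ is a noncommutative polynomial over $R$ in the symbols $R^H_K$, $I^H_K$, $C_{g,H}$ whose value in $\mu_R(G)$ is zero. Then $M\square N:=A/(FR+Rel)$ is a left $\mu_R(G)$-module, on which $R^H_K$, $I^H_K$, $C_{g,H}$ act through the operators above, and $\square$ is functorial in both arguments. **Lemma.** For all Mackey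 functors $M,N,P$ there is a bijection $$\mathrm{Dress}(M,N;P)\;\cong\;\hom_{\mu_R(G)}(\Phi M\square\Phi N,\ \Phi P),$$ natural in $M$, $N$ and $P$. If $\theta$ corresponds to $\beta$, then for every $H\le G$ the map $\theta_{G/H}$ is the restriction of $\beta$ to the first summand $M(G/H)\otimes N(G/H)$ of the grade $H$; and $\beta$ is obtained from $\theta$ grade by grade, by $\beta(m\otimes n)=\theta_{G/H}(m\otimes n)$ on the first summand of the grade $H$ and $\beta(I^H_Kx)=I^H_K\beta(x)$ for $K<H$ and $x\in A_K$. Moreover, composition with the quotient map $A\to\Phi M\square\Phi N$ is a bijection from $\hom_{\mu_R(G)}(\Phi M\square\Phi N,\Phi P)$ to the set of $R$-linear maps $A\to\Phi P$ that commute with all $R^H_K$, $I^H_K$, $C_{g,H}$ and vanish on $FR$. -/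

import Mathlib

open CategoryTheory Opposite
open scoped TensorProduct DirectSum

universe u v w

noncomputable section

namespace MackeyBox

/-! ### Finite `G`-sets and spans -/

/-- Finite `G`-sets. -/
structure FinGSet (G : Type u) [Group G] : Type (u + 1) where
  carrier : Type u
  [action : MulAction G carrier]
  [finite : Finite carrier]

attribute [instance] FinGSet.action FinGSet.finite

section GSets

variable {G : Type u} [Group G]

instance : CoeSort (FinGSet G) (Type u) := ⟨FinGSet.carrier⟩

/-- The empty `G`-set. -/
def FinGSet.empty (G : Type u) [Group G] : FinGSet G :=
  letI : MulAction G PEmpty.{u + 1} :=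
    { smul := fun _ x => x, one_smul := fun _ => rfl, mul_smul := fun _ _ _ => rfl }
  ⟨PEmpty.{u + 1}⟩

/-- The disjoint union of two finite `G`-sets. -/
def FinGSet.sum (V W : FinGSet G) : FinGSet G := ⟨V ⊕ W⟩

/-- The pullback `{(v, w) | f v = g w}` of finite `G`-sets. -/
def FinGSet.pullback {V W Y : FinGSet G} (f : V →[G] Y) (g : W →[G] Y) : FinGSet G :=
  letI : MulAction G {p : V × W // f p.1 = g p.2} :=
    { smul := fun a p => ⟨(a • p.1.1, a • p.1.2), by
        rw [map_smul, map_smul, p.2]⟩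
      one_smul := fun p => Subtype.ext (one_smul G p.1)
      mul_smul := fun a b p => Subtype.ext (mul_smul a b p.1) }
  ⟨{p : V × W // f p.1 = g p.2}⟩

/-- The transitive `G`-set `G/H`. -/
def orbit [Finite G] (H : Subgroup G) : FinGSet G := ⟨G ⧸ H⟩

/-- A span `X ← V → Y` of finite `G`-sets. -/
structure GSpan (X Y : FinGSet G) : Type (u + 1) where
  apex : FinGSet G
  left : apex →[G] X
  right : apex →[G] Y

/-- Two spans are equivalent if their apexes are isomorphic over `X` and `Y`. -/
def GSpan.Equivalent {X Y : FinGSet G} (S T : GSpan X Y) : Prop :=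
  ∃ σ : S.apex ≃ T.apex, (∀ (g : G) (v : S.apex), σ (g • v) = g • σ v) ∧
    (∀ v, T.left (σ v) = S.left v) ∧ (∀ v, T.right (σ v) = S.right v)

instance GSpan.setoid (X Y : FinGSet G) : Setoid (GSpan X Y) where
  r := GSpan.Equivalent
  iseqv :=
    { refl := fun _ => ⟨Equiv.refl _, fun _ _ => rfl, fun _ => rfl, fun _ => rfl⟩
      symm := by
        rintro S T ⟨σ, h, hl, hr⟩
        refine ⟨σ.symm, fun g v => ?_, fun v => ?_, fun v => ?_⟩
        · rw [Equiv.symm_apply_eq, h, Equiv.apply_symm_apply]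
        · rw [← hl, Equiv.apply_symm_apply]
        · rw [← hr, Equiv.apply_symm_apply]
      trans := by
        rintro S T U ⟨σ, h, hl, hr⟩ ⟨τ, k, kl, kr⟩
        refine ⟨σ.trans τ, fun g v => ?_, fun v => ?_, fun v => ?_⟩
        · simp [h, k]
        · simp [hl, kl]
        · simp [hr, kr] }

/-- `X ← ∅ → Y`. -/
def GSpan.zero (X Y : FinGSet G) : GSpan X Y where
  apex := FinGSet.empty G
  left := { toFun := fun x => PEmpty.elim x, map_smul' := fun _ x => PEmpty.elim x }
  right := { toFun := fun x => PEmpty.elim x, map_smul' := fun _ x => PEmpty.elim x }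

/-- `X ← V ⊔ V' → Y`. -/
def GSpan.add {X Y : FinGSet G} (S T : GSpan X Y) : GSpan X Y where
  apex := S.apex.sum T.apex
  left :=
    { toFun := fun x => Sum.elim S.left T.left x
      map_smul' := by rintro g (x | x) <;> exact map_smul _ _ _ }
  right :=
    { toFun := fun x => Sum.elim S.right T.right x
      map_smul' := by rintro g (x | x) <;> exact map_smul _ _ _ }

/-- Composition of `X ← V → Y` and `Y ← W → Z` by pullback. -/
def GSpan.comp {X Y Z : FinGSet G} (S : GSpan X Y) (T : GSpan Y Z) : GSpan X Z where
  apex := FinGSet.pullback S.right T.left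
  left :=
    { toFun := fun p => S.left p.1.1
      map_smul' := fun g p => map_smul S.left g p.1.1 }
  right :=
    { toFun := fun p => T.right p.1.2
      map_smul' := fun g p => map_smul T.right g p.1.2 }

/-- The restriction span `r_f : X = X → Y`. -/
def GSpan.res {X Y : FinGSet G} (f : X →[G] Y) : GSpan X Y := ⟨X, MulActionHom.id G, f⟩

/-- The transfer span `t_f : Y ← X = X`. -/
def GSpan.tr {X Y : FinGSet G} (f : X →[G] Y) : GSpan Y X := ⟨X, f, MulActionHom.id G⟩

/-- Morphisms `X → Y` in the category `ω(G)`: equivalence classes of spans. -/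
def SpanClass (X Y : FinGSet G) : Type (u + 1) := Quotient (GSpan.setoid X Y)

/-- The class of a span. -/
def SpanClass.mk {X Y : FinGSet G} (S : GSpan X Y) : SpanClass X Y := Quotient.mk _ S

theorem SpanClass.sound {X Y : FinGSet G} {S T : GSpan X Y} (h : S.Equivalent T) :
    SpanClass.mk S = SpanClass.mk T := Quotient.sound h

theorem SpanClass.ind {X Y : FinGSet G} {p : SpanClass X Y → Prop}
    (h : ∀ S, p (SpanClass.mk S)) (x : SpanClass X Y) : p x := Quotient.ind h x

instance (X Y : FinGSet G) : Zero (SpanClass X Y) := ⟨SpanClass.mk (GSpan.zero X Y)⟩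

instance (X Y : FinGSet G) : Add (SpanClass X Y) :=
  ⟨Quotient.map₂ GSpan.add (by
    rintro S S' ⟨σ, h, hl, hr⟩ T T' ⟨τ, k, kl, kr⟩
    refine ⟨Equiv.sumCongr σ τ, ?_, ?_, ?_⟩
    · rintro g (x | x)
      · exact congrArg Sum.inl (h g x)
      · exact congrArg Sum.inr (k g x)
    · rintro (x | x)
      · exact hl x
      · exact kl x
    · rintro (x | x)
      · exact hr x
      · exact kr x)⟩

theorem SpanClass.mk_add {X Y : FinGSet G} (S T : GSpan X Y) :
    SpanClass.mk S + SpanClass.mk T = SpanClass.mk (S.add T) := rfl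

theorem SpanClass.zero_def (X Y : FinGSet G) :
    (0 : SpanClass X Y) = SpanClass.mk (GSpan.zero X Y) := rfl

theorem SpanClass.add_comm' {X Y : FinGSet G} (a b : SpanClass X Y) : a + b = b + a := by
  induction a using SpanClass.ind with | h S =>
  induction b using SpanClass.ind with | h T =>
  refine SpanClass.sound ⟨Equiv.sumComm _ _, ?_, ?_, ?_⟩ <;> try rintro g (x | x) <;> rfl
  · rintro (x | x) <;> rfl
  · rintro (x | x) <;> rfl

theorem SpanClass.zero_add' {X Y : FinGSet G} (a : SpanClass X Y) : 0 + a = a := by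
  induction a using SpanClass.ind with | h S =>
  refine SpanClass.sound ⟨Equiv.emptySum PEmpty _, ?_, ?_, ?_⟩
  · rintro g (x | x)
    · exact PEmpty.elim x
    · rfl
  · rintro (x | x)
    · exact PEmpty.elim x
    · rfl
  · rintro (x | x)
    · exact PEmpty.elim x
    · rfl

/-- Disjoint union makes `hom_{ω(G)}(X, Y)` a commutative monoid. -/
instance (X Y : FinGSet G) : AddCommMonoid (SpanClass X Y) where
  add_assoc a b c := by
    induction a using SpanClass.ind with | h S =>
    induction b using SpanClass.ind with | h T =>
    induction c using SpanClass.ind with | h U =>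
    refine SpanClass.sound ⟨Equiv.sumAssoc _ _ _, ?_, ?_, ?_⟩
    · rintro g ((x | x) | x) <;> rfl
    · rintro ((x | x) | x) <;> rfl
    · rintro ((x | x) | x) <;> rfl
  zero_add := SpanClass.zero_add'
  add_zero a := by rw [SpanClass.add_comm', SpanClass.zero_add']
  add_comm := SpanClass.add_comm'
  nsmul := nsmulRec

/-- Composition in `ω(G)`. -/
def SpanClass.comp {X Y Z : FinGSet G} : SpanClass X Y → SpanClass Y Z → SpanClass X Z :=
  Quotient.map₂ GSpan.comp (by
    rintro S S' ⟨σ, h, hl, hr⟩ T T' ⟨τ, k, kl, kr⟩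
    refine ⟨Equiv.subtypeEquiv (Equiv.prodCongr σ τ) ?_, ?_, ?_, ?_⟩
    · rintro ⟨a, b⟩
      change S.right a = T.left b ↔ S'.right (σ a) = T'.left (τ b)
      rw [hr, kl]
    · rintro g p
      exact Subtype.ext (Prod.ext (h g p.1.1) (k g p.1.2))
    · rintro p
      exact hl p.1.1
    · rintro p
      exact kr p.1.2)

theorem SpanClass.mk_comp {X Y Z : FinGSet G} (S : GSpan X Y) (T : GSpan Y Z) :
    (SpanClass.mk S).comp (SpanClass.mk T) = SpanClass.mk (S.comp T) := rfl

theorem SpanClass.add_comp {X Y Z : FinGSet G} (a b : SpanClass X Y) (c : SpanClass Y Z) :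
    (a + b).comp c = a.comp c + b.comp c := by
  induction a using SpanClass.ind with | h S =>
  induction b using SpanClass.ind with | h T =>
  induction c using SpanClass.ind with | h U =>
  refine SpanClass.sound ⟨
    { toFun := fun p => match p with
        | ⟨(Sum.inl x, y), h⟩ => Sum.inl ⟨(x, y), h⟩
        | ⟨(Sum.inr x, y), h⟩ => Sum.inr ⟨(x, y), h⟩
      invFun := fun p => match p with
        | Sum.inl q => ⟨(Sum.inl q.1.1, q.1.2), q.2⟩
        | Sum.inr q => ⟨(Sum.inr q.1.1, q.1.2), q.2⟩
      left_inv := by rintro ⟨⟨x | x, y⟩, h⟩ <;> rfl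
      right_inv := by rintro (q | q) <;> rfl }, ?_, ?_, ?_⟩
  · rintro g ⟨⟨x | x, y⟩, h⟩ <;> rfl
  · rintro ⟨⟨x | x, y⟩, h⟩ <;> rfl
  · rintro ⟨⟨x | x, y⟩, h⟩ <;> rfl

theorem SpanClass.comp_add {X Y Z : FinGSet G} (c : SpanClass X Y) (a b : SpanClass Y Z) :
    c.comp (a + b) = c.comp a + c.comp b := by
  induction a using SpanClass.ind with | h S =>
  induction b using SpanClass.ind with | h T =>
  induction c using SpanClass.ind with | h U =>
  refine SpanClass.sound ⟨
    { toFun := fun p => match p with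
        | ⟨(y, Sum.inl x), h⟩ => Sum.inl ⟨(y, x), h⟩
        | ⟨(y, Sum.inr x), h⟩ => Sum.inr ⟨(y, x), h⟩
      invFun := fun p => match p with
        | Sum.inl q => ⟨(q.1.1, Sum.inl q.1.2), q.2⟩
        | Sum.inr q => ⟨(q.1.1, Sum.inr q.1.2), q.2⟩
      left_inv := by rintro ⟨⟨y, x | x⟩, h⟩ <;> rfl
      right_inv := by rintro (q | q) <;> rfl }, ?_, ?_, ?_⟩
  · rintro g ⟨⟨y, x | x⟩, h⟩ <;> rfl
  · rintro ⟨⟨y, x | x⟩, h⟩ <;> rfl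
  · rintro ⟨⟨y, x | x⟩, h⟩ <;> rfl

theorem SpanClass.zero_comp {X Y Z : FinGSet G} (c : SpanClass Y Z) :
    (0 : SpanClass X Y).comp c = 0 := by
  induction c using SpanClass.ind with | h U =>
  exact SpanClass.sound ⟨⟨fun p => PEmpty.elim p.1.1, fun p => PEmpty.elim p,
    fun p => PEmpty.elim p.1.1, fun p => PEmpty.elim p⟩,
    fun _ p => PEmpty.elim p.1.1, fun p => PEmpty.elim p.1.1, fun p => PEmpty.elim p.1.1⟩

theorem SpanClass.comp_zero {X Y Z : FinGSet G} (c : SpanClass X Y) :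
    c.comp (0 : SpanClass Y Z) = 0 := by
  induction c using SpanClass.ind with | h U =>
  exact SpanClass.sound ⟨⟨fun p => PEmpty.elim p.1.2, fun p => PEmpty.elim p,
    fun p => PEmpty.elim p.1.2, fun p => PEmpty.elim p⟩,
    fun _ p => PEmpty.elim p.1.2, fun p => PEmpty.elim p.1.2, fun p => PEmpty.elim p.1.2⟩

/-- The identity of `X` in `ω(G)`. -/
def SpanClass.id (X : FinGSet G) : SpanClass X X :=
  SpanClass.mk ⟨X, MulActionHom.id G, MulActionHom.id G⟩

theorem SpanClass.id_comp {X Y : FinGSet G} (a : SpanClass X Y) :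
    (SpanClass.id X).comp a = a := by
  induction a using SpanClass.ind with | h S =>
  exact SpanClass.sound ⟨⟨fun p => p.1.2, fun y => ⟨(S.left y, y), rfl⟩,
    fun p => Subtype.ext (Prod.ext p.2.symm rfl), fun _ => rfl⟩,
    fun _ _ => rfl, fun p => p.2.symm, fun _ => rfl⟩

theorem SpanClass.comp_id {X Y : FinGSet G} (a : SpanClass X Y) :
    a.comp (SpanClass.id Y) = a := by
  induction a using SpanClass.ind with | h S =>
  exact SpanClass.sound ⟨⟨fun p => p.1.1, fun y => ⟨(y, S.right y), rfl⟩,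
    fun p => Subtype.ext (Prod.ext rfl p.2), fun _ => rfl⟩,
    fun _ _ => rfl, fun _ => rfl, fun p => p.2⟩

theorem SpanClass.comp_assoc {W X Y Z : FinGSet G} (a : SpanClass W X) (b : SpanClass X Y)
    (c : SpanClass Y Z) : (a.comp b).comp c = a.comp (b.comp c) := by
  induction a using SpanClass.ind with | h S =>
  induction b using SpanClass.ind with | h T =>
  induction c using SpanClass.ind with | h U =>
  exact SpanClass.sound
    ⟨⟨fun p => ⟨(p.1.1.1.1, ⟨(p.1.1.1.2, p.1.2), p.2⟩), p.1.1.2⟩,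
      fun p => ⟨(⟨(p.1.1, p.1.2.1.1), p.2⟩, p.1.2.1.2), p.1.2.2⟩,
      fun _ => rfl, fun _ => rfl⟩, fun _ _ => rfl, fun _ => rfl, fun _ => rfl⟩

/-- Composition in `ω(G)` as a biadditive map. -/
def SpanClass.compHom (X Y Z : FinGSet G) :
    SpanClass X Y →ₗ[ℕ] SpanClass Y Z →ₗ[ℕ] SpanClass X Z :=
  AddMonoidHom.toNatLinearMap
    { toFun := fun a => AddMonoidHom.toNatLinearMap
        { toFun := fun b => a.comp b
          map_zero' := SpanClass.comp_zero a
          map_add' := SpanClass.comp_add a }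
      map_zero' := by
        ext c
        exact SpanClass.zero_comp c
      map_add' := fun a b => by
        ext c
        exact SpanClass.add_comp a b c }

theorem SpanClass.compHom_apply {X Y Z : FinGSet G} (a : SpanClass X Y) (b : SpanClass Y Z) :
    SpanClass.compHom X Y Z a b = a.comp b := rfl

end GSets

/-! ### The category `Ω_R(G)` -/

/-- The category `Ω_R(G)`: its objects are the finite `G`-sets. -/
structure Omega (R : Type w) (G : Type u) [Group G] : Type (u + 1) where
  gset : FinGSet G

variable {R : Type w} [CommRing R] {G : Type u} [Group G]

/-- `hom_{Ω_R(G)}(X, Y)`: the extension of scalars from `ℕ` to `R` of the commutative monoid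
`hom_{ω(G)}(X, Y)`.  As the latter is a free commutative monoid, this is the free `R`-module on
the same basis. -/
def Omega.Hom (R : Type w) [CommRing R] (X Y : FinGSet G) : Type (max w (u + 1)) :=
  R ⊗[ℕ] SpanClass X Y

instance (X Y : FinGSet G) : AddCommMonoid (Omega.Hom R X Y) :=
  inferInstanceAs (AddCommMonoid (R ⊗[ℕ] SpanClass X Y))

instance (X Y : FinGSet G) : Module R (Omega.Hom R X Y) :=
  inferInstanceAs (Module R (R ⊗[ℕ] SpanClass X Y))

instance (X Y : FinGSet G) : AddCommGroup (Omega.Hom R X Y) :=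
  Module.addCommMonoidToAddCommGroup R

/-- `R`-bilinear extension of the composition in `ω(G)`. -/
def Omega.compAux (X Y Z : FinGSet G) :
    (R ⊗[ℕ] SpanClass X Y) →ₗ[R] (R ⊗[ℕ] SpanClass Y Z) →ₗ[R] (R ⊗[ℕ] SpanClass X Z) :=
  LinearMap.liftBaseChange R
    ((LinearMap.baseChangeHom ℕ R (SpanClass Y Z) (SpanClass X Z)) ∘ₗ SpanClass.compHom X Y Z)

/-- Composition in `Ω_R(G)`, as an `R`-bilinear map. -/
def Omega.compHom (X Y Z : FinGSet G) :
    Omega.Hom R X Y →ₗ[R] Omega.Hom R Y Z →ₗ[R] Omega.Hom R X Z :=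
  Omega.compAux X Y Z

/-- The multiple `r • [S]` of a class of spans, in `hom_{Ω_R(G)}(X, Y)`. -/
def Omega.Hom.tmul {X Y : FinGSet G} (r : R) (a : SpanClass X Y) : Omega.Hom R X Y :=
  r ⊗ₜ[ℕ] a

theorem Omega.compHom_tmul {X Y Z : FinGSet G} (r s : R) (a : SpanClass X Y)
    (b : SpanClass Y Z) :
    Omega.compHom X Y Z (Omega.Hom.tmul r a) (Omega.Hom.tmul s b)
      = Omega.Hom.tmul (r * s) (a.comp b) := by
  change Omega.compAux X Y Z (r ⊗ₜ[ℕ] a) (s ⊗ₜ[ℕ] b) = ((r * s) ⊗ₜ[ℕ] a.comp b)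
  unfold Omega.compAux
  rw [LinearMap.liftBaseChange_tmul, LinearMap.smul_apply]
  change r • (s ⊗ₜ[ℕ] a.comp b) = _
  rw [TensorProduct.smul_tmul', smul_eq_mul]

theorem Omega.Hom.induction {X Y : FinGSet G} {p : Omega.Hom R X Y → Prop}
    (h0 : p 0) (h1 : ∀ (r : R) (a : SpanClass X Y), p (Omega.Hom.tmul r a))
    (h2 : ∀ x y, p x → p y → p (x + y)) (x : Omega.Hom R X Y) : p x :=
  TensorProduct.induction_on x h0 h1 h2

theorem Omega.compHom_assoc {W X Y Z : FinGSet G} (a : Omega.Hom R W X) (b : Omega.Hom R X Y)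
    (c : Omega.Hom R Y Z) :
    Omega.compHom W Y Z (Omega.compHom W X Y a b) c =
      Omega.compHom W X Z a (Omega.compHom X Y Z b c) := by
  induction a using Omega.Hom.induction with
  | h0 => simp
  | h2 x y hx hy => simp [hx, hy]
  | h1 r a =>
    induction b using Omega.Hom.induction with
    | h0 => simp
    | h2 x y hx hy => simp [hx, hy]
    | h1 s b =>
      induction c using Omega.Hom.induction with
      | h0 => simp
      | h2 x y hx hy => simp [hx, hy]
      | h1 t c =>
        rw [Omega.compHom_tmul, Omega.compHom_tmul, Omega.compHom_tmul, Omega.compHom_tmul,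
          SpanClass.comp_assoc, mul_assoc]

theorem Omega.id_compHom {X Y : FinGSet G} (a : Omega.Hom R X Y) :
    Omega.compHom X X Y (Omega.Hom.tmul 1 (SpanClass.id X)) a = a := by
  induction a using Omega.Hom.induction with
  | h0 => simp
  | h2 x y hx hy => rw [map_add, hx, hy]
  | h1 r a => rw [Omega.compHom_tmul, SpanClass.id_comp, one_mul]

theorem Omega.compHom_id {X Y : FinGSet G} (a : Omega.Hom R X Y) :
    Omega.compHom X Y Y a (Omega.Hom.tmul 1 (SpanClass.id Y)) = a := by
  induction a using Omega.Hom.induction with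
  | h0 => simp
  | h2 x y hx hy => rw [map_add, LinearMap.add_apply, hx, hy]
  | h1 r a => rw [Omega.compHom_tmul, SpanClass.comp_id, mul_one]

instance : Category.{max w (u + 1)} (Omega R G) where
  Hom X Y := Omega.Hom R X.gset Y.gset
  id X := Omega.Hom.tmul 1 (SpanClass.id X.gset)
  comp f g := Omega.compHom _ _ _ f g
  id_comp f := Omega.id_compHom f
  comp_id f := Omega.compHom_id f
  assoc f g h := Omega.compHom_assoc f g h

instance : Preadditive (Omega R G) where
  homGroup X Y := inferInstanceAs (AddCommGroup (Omega.Hom R X.gset Y.gset))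
  add_comp X Y Z f g h := LinearMap.map_add₂ (Omega.compHom X.gset Y.gset Z.gset) f g h
  comp_add X Y Z f g h :=
    (Omega.compHom X.gset Y.gset Z.gset f).map_add g h

instance : Linear R (Omega R G) where
  homModule X Y := inferInstanceAs (Module R (Omega.Hom R X.gset Y.gset))
  smul_comp X Y Z r f g := LinearMap.map_smul₂ (Omega.compHom X.gset Y.gset Z.gset) r f g
  comp_smul X Y Z f r g :=
    (Omega.compHom X.gset Y.gset Z.gset f).map_smul r g

/-- The morphism of `Ω_R(G)` given by a span. -/
def Omega.span {X Y : Omega R G} (S : GSpan X.gset Y.gset) : X ⟶ Y :=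
  Omega.Hom.tmul 1 (SpanClass.mk S)

theorem Omega.span_comp {X Y Z : Omega R G} (S : GSpan X.gset Y.gset) (T : GSpan Y.gset Z.gset) :
    Omega.span S ≫ Omega.span T = (Omega.span (S.comp T) : X ⟶ Z) := by
  refine (Omega.compHom_tmul _ _ _ _).trans ?_
  rw [one_mul]; rfl

theorem Omega.span_eq {X Y : Omega R G} {S T : GSpan X.gset Y.gset} (h : S.Equivalent T) :
    (Omega.span S : X ⟶ Y) = Omega.span T := by
  unfold Omega.span
  rw [SpanClass.sound h]

/-- The restriction `r_f : X = X → Y` as a morphism `X ⟶ Y` of `Ω_R(G)`. -/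
def Omega.res {X Y : Omega R G} (f : X.gset →[G] Y.gset) : X ⟶ Y := Omega.span (GSpan.res f)

/-- The transfer `t_f : Y ← X = X` as a morphism `Y ⟶ X` of `Ω_R(G)`. -/
def Omega.tr {X Y : Omega R G} (f : X.gset →[G] Y.gset) : Y ⟶ X := Omega.span (GSpan.tr f)

/-! ### The Mackey algebra -/

/-- The object `G/H` of `Ω_R(G)`. -/
abbrev orb (R : Type w) [CommRing R] [Finite G] (H : Subgroup G) : Omega R G := ⟨orbit H⟩

instance subgroupFintype [Finite G] : Fintype (Subgroup G) := Fintype.ofFinite _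

variable (R G) in
/-- The Mackey algebra `μ_R(G) = ⨁_{H, K ≤ G} hom_{Ω_R(G)}(G/H, G/K)`.  As `G` has finitely many
subgroups, the direct sum is a product. -/
def MackeyAlgebra [Finite G] : Type (max w (u + 1)) :=
  ∀ H K : Subgroup G, (orb R H ⟶ orb R K)

namespace MackeyAlgebra

variable [Finite G]

instance : AddCommGroup (MackeyAlgebra R G) :=
  inferInstanceAs (AddCommGroup (∀ H K : Subgroup G, (orb R H ⟶ orb R K)))

instance : Module R (MackeyAlgebra R G) :=
  inferInstanceAs (Module R (∀ H K : Subgroup G, (orb R H ⟶ orb R K)))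

@[ext] theorem ext {a b : MackeyAlgebra R G} (h : ∀ H K, a H K = b H K) : a = b :=
  funext fun H => funext fun K => h H K

@[simp] theorem add_app (a b : MackeyAlgebra R G) (H K : Subgroup G) :
    (a + b) H K = a H K + b H K := rfl

@[simp] theorem zero_app (H K : Subgroup G) : (0 : MackeyAlgebra R G) H K = 0 := rfl

@[simp] theorem smul_app (r : R) (a : MackeyAlgebra R G) (H K : Subgroup G) :
    (r • a) H K = r • a H K := rfl

open Classical in
/-- A morphism `G/H → G/K` as an element of the Mackey algebra. -/
def single (H K : Subgroup G) (f : orb R H ⟶ orb R K) : MackeyAlgebra R G :=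
  Pi.single H (Pi.single K f)

/-- Multiplication is composition of composable components (in the order of the diagrams), and
zero on non-composable ones. -/
instance : Mul (MackeyAlgebra R G) := ⟨fun a b H L => ∑ K, a H K ≫ b K L⟩

open Classical in
instance : One (MackeyAlgebra R G) := ⟨∑ H, single H H (𝟙 _)⟩

theorem mul_app (a b : MackeyAlgebra R G) (H L : Subgroup G) :
    (a * b) H L = ∑ K, a H K ≫ b K L := rfl

theorem single_same (H K : Subgroup G) (f : orb R H ⟶ orb R K) : single H K f H K = f := by
  simp [single]

theorem single_of_ne_left {H K H' : Subgroup G} (f : orb R H ⟶ orb R K) (h : H' ≠ H)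
    (K' : Subgroup G) : single H K f H' K' = 0 := by
  simp [single, h]

theorem single_of_ne_right {H K K' : Subgroup G} (f : orb R H ⟶ orb R K) (h : K' ≠ K)
    (H' : Subgroup G) : single H K f H' K' = 0 := by
  by_cases hH : H' = H
  · subst hH
    simp [single, h]
  · exact single_of_ne_left f hH K'

@[simp] theorem sum_app {ι : Type*} (s : Finset ι) (f : ι → MackeyAlgebra R G)
    (H K : Subgroup G) : (∑ i ∈ s, f i) H K = ∑ i ∈ s, f i H K := by
  classical
  induction s using Finset.induction_on with
  | empty => simp
  | insert i s hi ih => rw [Finset.sum_insert hi, Finset.sum_insert hi, add_app, ih]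

theorem one_app_same (H : Subgroup G) : (1 : MackeyAlgebra R G) H H = 𝟙 _ := by
  change (∑ K, single K K (𝟙 _) : MackeyAlgebra R G) H H = _
  rw [sum_app, Finset.sum_eq_single H, single_same]
  · intro K _ hK
    exact single_of_ne_left _ (Ne.symm hK) _
  · simp

theorem one_app_ne {H K : Subgroup G} (h : H ≠ K) : (1 : MackeyAlgebra R G) H K = 0 := by
  change (∑ L, single L L (𝟙 _) : MackeyAlgebra R G) H K = _
  rw [sum_app]
  refine Finset.sum_eq_zero fun L _ => ?_
  by_cases hL : H = L
  · subst hL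
    exact single_of_ne_right _ (Ne.symm h) _
  · exact single_of_ne_left _ hL _

instance : Ring (MackeyAlgebra R G) :=
  { (inferInstance : AddCommGroup (MackeyAlgebra R G)) with
    mul := (· * ·)
    one := 1
    left_distrib := fun a b c => by
      ext H L
      simp [mul_app, Finset.sum_add_distrib]
    right_distrib := fun a b c => by
      ext H L
      simp [mul_app, Finset.sum_add_distrib]
    zero_mul := fun a => by
      ext H L
      simp [mul_app]
    mul_zero := fun a => by
      ext H L
      simp [mul_app]
    mul_assoc := fun a b c => by
      ext H L
      simp only [mul_app, Preadditive.sum_comp, Preadditive.comp_sum, Category.assoc]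
      exact Finset.sum_comm
    one_mul := fun a => by
      ext H L
      rw [mul_app, Finset.sum_eq_single H, one_app_same, Category.id_comp]
      · intro K _ hK
        rw [one_app_ne (Ne.symm hK), Limits.zero_comp]
      · simp
    mul_one := fun a => by
      ext H L
      rw [mul_app, Finset.sum_eq_single L, one_app_same, Category.comp_id]
      · intro K _ hK
        rw [one_app_ne hK, Limits.comp_zero]
      · simp }

instance : Algebra R (MackeyAlgebra R G) :=
  Algebra.ofModule
    (fun r a b => by
      ext H L
      simp [mul_app, Finset.smul_sum])
    (fun r a b => by
      ext H L
      simp [mul_app, Finset.smul_sum])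

theorem single_mul_single (H K L : Subgroup G) (f : orb R H ⟶ orb R K) (g : orb R K ⟶ orb R L) :
    single H K f * single K L g = single H L (f ≫ g) := by
  ext A B
  rw [mul_app, Finset.sum_eq_single K]
  · by_cases hA : A = H
    · subst hA
      by_cases hB : B = L
      · subst hB
        simp only [single_same]
      · simp only [single_of_ne_right _ hB, Limits.comp_zero]
    · simp only [single_of_ne_left _ hA, Limits.zero_comp]
  · intro J _ hJ
    rw [single_of_ne_right _ hJ, Limits.zero_comp]
  · simp

theorem single_add (H K : Subgroup G) (f g : orb R H ⟶ orb R K) :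
    single H K (f + g) = single H K f + single H K g := by
  simp only [single, Pi.single_add]
  rfl

theorem single_smul (H K : Subgroup G) (r : R) (f : orb R H ⟶ orb R K) :
    single H K (r • f) = r • single H K f := by
  simp only [single, Pi.single_smul]
  rfl

theorem eq_sum_single (a : MackeyAlgebra R G) : a = ∑ H, ∑ K, single H K (a H K) := by
  ext A B
  rw [sum_app, Finset.sum_eq_single A, sum_app, Finset.sum_eq_single B, single_same]
  · intro K _ hK
    exact single_of_ne_right _ (Ne.symm hK) _
  · simp
  · intro H _ hH
    rw [sum_app]
    exact Finset.sum_eq_zero fun K _ => single_of_ne_left _ (Ne.symm hH) _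
  · simp

end MackeyAlgebra

/-! ### The elements `R^H_K`, `I^H_K` and `C_{g,H}` -/

/-- The conjugate subgroup `ᵍH = g H g⁻¹`. -/
def conj (g : G) (H : Subgroup G) : Subgroup G := H.map (MulAut.conj g).toMonoidHom

theorem mem_conj {g x : G} {H : Subgroup G} : x ∈ conj g H ↔ g⁻¹ * x * g ∈ H := by
  unfold conj
  rw [Subgroup.mem_map]
  constructor
  · rintro ⟨y, hy, rfl⟩
    simpa [mul_assoc] using hy
  · intro h
    exact ⟨_, h, by simp [mul_assoc]⟩

theorem conj_mono (g : G) {K H : Subgroup G} (h : K ≤ H) : conj g K ≤ conj g H :=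
  Subgroup.map_mono h

theorem conj_lt (g : G) {K H : Subgroup G} (h : K < H) : conj g K < conj g H :=
  (Subgroup.map_lt_map_iff_of_injective (MulAut.conj g).injective).2 h

section Finite

variable [Finite G]

/-- The canonical map `π^H_K : G/K → G/H`. -/
def proj {K H : Subgroup G} (h : K ≤ H) : orbit K →[G] orbit H where
  toFun := Subgroup.quotientMapOfLE h
  map_smul' g x := by
    induction x using Quotient.inductionOn'
    rfl

/-- The conjugation map `c_{g,H} : G/H → G/ᵍH`, `kH ↦ (k g⁻¹) ᵍH`. -/
def cmap (g : G) (H : Subgroup G) : orbit H →[G] orbit (conj g H) where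
  toFun := fun x => Quotient.liftOn' x (fun k => ((k * g⁻¹ : G) : G ⧸ conj g H)) (by
    intro a b hab
    rw [QuotientGroup.leftRel_apply] at hab
    refine QuotientGroup.eq.2 (mem_conj.2 ?_)
    simpa [mul_assoc] using hab)
  map_smul' a x := by
    induction x using Quotient.inductionOn'
    exact congrArg (fun z : G => (z : G ⧸ conj g H)) (mul_assoc _ _ _)

namespace MackeyAlgebra

/-- `R^H_K`. -/
def resEl {K H : Subgroup G} (h : K ≤ H) : MackeyAlgebra R G :=
  single K H (Omega.res (X := orb R K) (Y := orb R H) (proj h))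

/-- `I^H_K`. -/
def indEl {K H : Subgroup G} (h : K ≤ H) : MackeyAlgebra R G :=
  single H K (Omega.tr (X := orb R K) (Y := orb R H) (proj h))

/-- `C_{g,H}`. -/
def conEl (g : G) (H : Subgroup G) : MackeyAlgebra R G :=
  single (conj g H) H (Omega.tr (X := orb R H) (Y := orb R (conj g H)) (cmap g H))

theorem tr_proj_self (H : Subgroup G) :
    Omega.tr (X := orb R H) (Y := orb R H) (proj (le_refl H)) = 𝟙 (orb R H) := by
  refine (Omega.span_eq (T := ⟨orbit H, MulActionHom.id G, MulActionHom.id G⟩) ?_).trans rfl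
  refine ⟨Equiv.refl _, fun _ _ => rfl, fun v => ?_, fun _ => rfl⟩
  induction v using Quotient.inductionOn'
  rfl

theorem indEl_self (H : Subgroup G) : (indEl (le_refl H) : MackeyAlgebra R G) = single H H (𝟙 _) := by
  unfold indEl
  rw [tr_proj_self]

theorem indEl_self_mul_single (H K : Subgroup G) (f : orb R H ⟶ orb R K) :
    indEl (le_refl H) * single H K f = single H K f := by
  rw [indEl_self, single_mul_single, Category.id_comp]

end MackeyAlgebra

end Finite

/-- Symbols for the elements `R^H_K`, `I^H_K` (`K ≤ H`) and `C_{g,H}`. -/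
inductive Gen (G : Type u) [Group G] : Type u
  | res (K H : Subgroup G) (h : K ≤ H)
  | ind (K H : Subgroup G) (h : K ≤ H)
  | con (g : G) (H : Subgroup G)

/-- The element of the Mackey algebra named by a symbol. -/
def Gen.elem (R : Type w) [CommRing R] [Finite G] : Gen G → MackeyAlgebra R G
  | .res _ _ h => MackeyAlgebra.resEl h
  | .ind _ _ h => MackeyAlgebra.indEl h
  | .con g H => MackeyAlgebra.conEl g H

/-- The evaluation of noncommutative polynomials in the symbols in `μ_R(G)`. -/
def evalGen (R : Type w) [CommRing R] (G : Type u) [Group G] [Finite G] :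
    FreeAlgebra R (Gen G) →ₐ[R] MackeyAlgebra R G :=
  FreeAlgebra.lift R (Gen.elem R)

theorem Omega.tr_comp_tr {X Y Z : Omega R G} (f : X.gset →[G] Y.gset) (g : Y.gset →[G] Z.gset) :
    (Omega.tr g : Z ⟶ Y) ≫ Omega.tr f = Omega.tr (g.comp f) := by
  unfold Omega.tr
  rw [Omega.span_comp]
  exact Omega.span_eq ⟨⟨fun p => p.1.2, fun x => ⟨(f x, x), rfl⟩,
    fun p => Subtype.ext (Prod.ext p.2.symm rfl), fun _ => rfl⟩, fun _ _ => rfl,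
    fun p => congrArg g p.2.symm, fun _ => rfl⟩

theorem Omega.tr_comp_res {X Y Z : Omega R G} (f : Y.gset →[G] X.gset) (g : Y.gset →[G] Z.gset) :
    (Omega.tr f : X ⟶ Y) ≫ Omega.res g = Omega.span ⟨Y.gset, f, g⟩ := by
  unfold Omega.tr Omega.res
  rw [Omega.span_comp]
  exact Omega.span_eq ⟨⟨fun p => p.1.2, fun x => ⟨(x, x), rfl⟩,
    fun p => Subtype.ext (Prod.ext p.2.symm rfl), fun _ => rfl⟩, fun _ _ => rfl,
    fun p => congrArg f p.2.symm, fun _ => rfl⟩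

/-- The restriction of a span to a `G`-stable part of its middle term. -/
def GSpan.restrict {X Y : FinGSet G} (S : GSpan X Y) (p : S.apex → Prop)
    (hp : ∀ (g : G) x, p x → p (g • x)) : GSpan X Y :=
  letI : MulAction G {x : S.apex // p x} :=
    { smul := fun g x => ⟨g • x.1, hp g x.1 x.2⟩
      one_smul := fun x => Subtype.ext (one_smul G x.1)
      mul_smul := fun a b x => Subtype.ext (mul_smul a b x.1) }
  { apex := ⟨{x : S.apex // p x}⟩
    left := { toFun := fun x => S.left x.1, map_smul' := fun g x => map_smul S.left g x.1 }
    right := { toFun := fun x => S.right x.1, map_smul' := fun g x => map_smul S.right g x.1 } }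

theorem Omega.span_add {X Y : Omega R G} (S T : GSpan X.gset Y.gset) :
    (Omega.span (S.add T) : X ⟶ Y) = Omega.span S + Omega.span T :=
  TensorProduct.tmul_add (R := ℕ) (1 : R) (SpanClass.mk S) (SpanClass.mk T)

theorem Omega.span_zero (X Y : Omega R G) :
    (Omega.span (GSpan.zero X.gset Y.gset) : X ⟶ Y) = 0 :=
  TensorProduct.tmul_zero (R := ℕ) (SpanClass X.gset Y.gset) (1 : R)

section Surjective

variable [Finite G]

theorem evalGen_ι (s : Gen G) : evalGen R G (FreeAlgebra.ι R s) = s.elem R := by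
  simp [evalGen]

theorem MackeyAlgebra.single_zero (H K : Subgroup G) :
    MackeyAlgebra.single H K (0 : orb R H ⟶ orb R K) = 0 := by
  simpa using MackeyAlgebra.single_smul H K (0 : R) (0 : orb R H ⟶ orb R K)

open MackeyAlgebra in
/-- A span with transitive middle term is a product of the special elements. -/
theorem single_orbit_mem {H K : Subgroup G} (S : GSpan (orbit H) (orbit K)) (x : S.apex)
    (hx : ∀ y : S.apex, ∃ g : G, g • x = y) :
    single H K (Omega.span (X := orb R H) (Y := orb R K) S) ∈ (evalGen R G).range := by
  obtain ⟨b, hb⟩ := QuotientGroup.mk_surjective (S.right x : G ⧸ K)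
  obtain ⟨x', hx', hK, hr⟩ : ∃ x' : S.apex, (∀ y : S.apex, ∃ g : G, g • x' = y) ∧
      MulAction.stabilizer G x' ≤ K ∧ S.right x' = ((1 : G) : G ⧸ K) := by
    have h1 : S.right (b⁻¹ • x) = ((1 : G) : G ⧸ K) := by
      rw [map_smul, ← hb]
      exact congrArg (fun z : G => (z : G ⧸ K)) (inv_mul_cancel b)
    refine ⟨b⁻¹ • x, fun y => ?_, fun g hg => ?_, h1⟩
    · obtain ⟨g, rfl⟩ := hx y
      exact ⟨g * b, by simp [mul_smul]⟩
    · have h2 : g • S.right (b⁻¹ • x) = S.right (b⁻¹ • x) := by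
        rw [← map_smul, MulAction.mem_stabilizer_iff.1 hg]
      rw [h1] at h2
      have h3 : ((g * 1 : G) : G ⧸ K) = ((1 : G) : G ⧸ K) := h2
      rw [QuotientGroup.eq] at h3
      simpa using h3
  clear hx hb
  obtain ⟨a, ha⟩ := QuotientGroup.mk_surjective (S.left x' : G ⧸ H)
  set L := MulAction.stabilizer G x' with hL
  have hH : conj a⁻¹ L ≤ H := by
    intro z hz
    rw [mem_conj] at hz
    have h2 : (a⁻¹⁻¹ * z * a⁻¹) • S.left x' = S.left x' := by
      rw [← map_smul, MulAction.mem_stabilizer_iff.1 hz]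
    rw [← ha] at h2
    have h3 : ((a⁻¹⁻¹ * z * a⁻¹ * a : G) : G ⧸ H) = ((a : G) : G ⧸ H) := h2
    rw [QuotientGroup.eq] at h3
    simpa [mul_assoc] using H.inv_mem h3
  have key : single H K (Omega.span (X := orb R H) (Y := orb R K) S) =
      indEl hH * conEl a⁻¹ L * (resEl hK : MackeyAlgebra R G) := by
    unfold indEl conEl resEl
    rw [single_mul_single, single_mul_single, Omega.tr_comp_tr, Omega.tr_comp_res]
    congr 1
    refine (Omega.span_eq ⟨Equiv.ofBijective (MulAction.ofQuotientStabilizer G x')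
      ⟨MulAction.injective_ofQuotientStabilizer G x', fun y => ?_⟩, ?_, ?_, ?_⟩).symm
    · obtain ⟨g, rfl⟩ := hx' y
      exact ⟨(g : G ⧸ L), rfl⟩
    · intro g v
      induction v using Quotient.inductionOn' with | h k =>
      exact mul_smul g k x'
    · intro v
      induction v using Quotient.inductionOn' with | h k =>
      change S.left (k • x') = ((k * a⁻¹⁻¹ : G) : G ⧸ H)
      rw [map_smul, ← ha, inv_inv]
      rfl
    · intro v
      induction v using Quotient.inductionOn' with | h k =>
      change S.right (k • x') = ((k : G) : G ⧸ K)
      rw [map_smul, hr]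
      exact congrArg (fun z : G => (z : G ⧸ K)) (mul_one k)
  rw [key]
  exact mul_mem (mul_mem ⟨FreeAlgebra.ι R (.ind _ _ hH), evalGen_ι _⟩
    ⟨FreeAlgebra.ι R (.con _ _), evalGen_ι _⟩) ⟨FreeAlgebra.ι R (.res _ _ hK), evalGen_ι _⟩

open MackeyAlgebra in
theorem single_span_mem {H K : Subgroup G} (n : ℕ) (S : GSpan (orbit H) (orbit K))
    (hn : Nat.card S.apex ≤ n) :
    single H K (Omega.span (X := orb R H) (Y := orb R K) S) ∈ (evalGen R G).range := by
  induction n generalizing S with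
  | zero =>
    have hE : IsEmpty S.apex := Finite.card_eq_zero_iff.1 (Nat.le_zero.1 hn)
    have h0 : Omega.span (X := orb R H) (Y := orb R K) S = 0 := by
      refine (Omega.span_eq (T := GSpan.zero (orbit H) (orbit K)) ?_).trans
        (Omega.span_zero (orb R H) (orb R K))
      exact ⟨⟨fun x => (hE.false x).elim, fun x => PEmpty.elim x, fun x => (hE.false x).elim,
        fun x => PEmpty.elim x⟩, fun _ x => (hE.false x).elim, fun x => (hE.false x).elim,
        fun x => (hE.false x).elim⟩
    rw [h0, MackeyAlgebra.single_zero]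
    exact zero_mem _
  | succ n ih =>
    by_cases hE : IsEmpty S.apex
    · exact ih S (by rw [Finite.card_eq_zero_iff.2 hE]; exact Nat.zero_le _)
    · obtain ⟨x⟩ := not_isEmpty_iff.1 hE
      classical
      have hp : ∀ (g : G) y, (∃ k : G, k • x = y) → ∃ k : G, k • x = g • y := by
        rintro g y ⟨k, rfl⟩
        exact ⟨g * k, mul_smul g k x⟩
      have hq : ∀ (g : G) y, (¬ ∃ k : G, k • x = y) → ¬ ∃ k : G, k • x = g • y := by
        rintro g y h ⟨k, hk⟩
        exact h ⟨g⁻¹ * k, by rw [mul_smul, hk, inv_smul_smul]⟩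
      have hS : Omega.span (X := orb R H) (Y := orb R K) S =
          Omega.span (X := orb R H) (Y := orb R K) (S.restrict _ hp) +
            Omega.span (X := orb R H) (Y := orb R K) (S.restrict _ hq) := by
        rw [← Omega.span_add]
        refine (Omega.span_eq ⟨Equiv.sumCompl (fun y => ∃ k : G, k • x = y), ?_, ?_, ?_⟩).symm
        · rintro g (y | y) <;> rfl
        · rintro (y | y) <;> rfl
        · rintro (y | y) <;> rfl
      rw [hS, MackeyAlgebra.single_add]
      refine add_mem (single_orbit_mem _ ⟨x, 1, one_smul G x⟩ ?_) (ih _ ?_)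
      · rintro ⟨y, k, rfl⟩
        exact ⟨k, rfl⟩
      · have h1 : Nat.card {y : S.apex // ¬ ∃ k : G, k • x = y} < Nat.card S.apex :=
          Finite.card_subtype_lt (x := x) (by simpa using ⟨1, one_smul G x⟩)
        exact Nat.lt_succ_iff.1 (lt_of_lt_of_le h1 hn)

/-- The Mackey algebra is generated by the elements `R^H_K`, `I^H_K`, `C_{g,H}`. -/
theorem evalGen_surjective : Function.Surjective (evalGen R G) := by
  rw [← AlgHom.range_eq_top, eq_top_iff]
  intro a _
  rw [MackeyAlgebra.eq_sum_single a]
  refine sum_mem fun H _ => sum_mem fun K _ => ?_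
  generalize a H K = f
  change Omega.Hom R (orbit H) (orbit K) at f
  induction f using Omega.Hom.induction with
  | h0 =>
    exact (MackeyAlgebra.single_zero (R := R) H K) ▸ zero_mem _
  | h2 x y hx hy =>
    exact (MackeyAlgebra.single_add H K (x : orb R H ⟶ orb R K) y) ▸ add_mem hx hy
  | h1 r b =>
    induction b using SpanClass.ind with | h S =>
    have : (Omega.Hom.tmul r (SpanClass.mk S) : orb R H ⟶ orb R K) =
        r • Omega.span (X := orb R H) (Y := orb R K) S := by
      change (r ⊗ₜ[ℕ] SpanClass.mk S : R ⊗[ℕ] SpanClass (orbit H) (orbit K)) =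
        r • ((1 : R) ⊗ₜ[ℕ] SpanClass.mk S : R ⊗[ℕ] SpanClass (orbit H) (orbit K))
      rw [TensorProduct.smul_tmul', smul_eq_mul, mul_one]
    have h := Subalgebra.smul_mem _ (single_span_mem (R := R) _ S le_rfl) r
    rw [← MackeyAlgebra.single_smul, ← this] at h
    exact h

end Surjective

/-! ### The box product of two left `μ_R(G)`-modules -/

section Grade

variable [Finite G] {M : Type*} [AddCommGroup M] [Module R M] [Module (MackeyAlgebra R G) M]
  [IsScalarTower R (MackeyAlgebra R G) M]

variable (R M) in
/-- The grade `I^H_H M` of a left `μ_R(G)`-module `M`. -/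
def grade (H : Subgroup G) : Submodule R M :=
  LinearMap.range (Algebra.lsmul R R M (MackeyAlgebra.indEl (le_refl H) : MackeyAlgebra R G))

theorem mem_grade {H : Subgroup G} {x : M} :
    x ∈ grade R M H ↔ (MackeyAlgebra.indEl (le_refl H) : MackeyAlgebra R G) • x = x := by
  constructor
  · rintro ⟨y, rfl⟩
    change (MackeyAlgebra.indEl (le_refl H) : MackeyAlgebra R G) •
      ((MackeyAlgebra.indEl (le_refl H) : MackeyAlgebra R G) • y) =
      (MackeyAlgebra.indEl (le_refl H) : MackeyAlgebra R G) • y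
    rw [← mul_smul, MackeyAlgebra.indEl_self, MackeyAlgebra.single_mul_single, Category.id_comp]
  · intro h
    exact ⟨x, h⟩

variable (M) in
/-- Multiplication by an element of `hom_{Ω_R(G)}(G/H, G/K)`, as a map `I^K_K M → I^H_H M`. -/
def gradeMul {H K : Subgroup G} (f : orb R H ⟶ orb R K) : grade R M K →ₗ[R] grade R M H :=
  ((Algebra.lsmul R R M (MackeyAlgebra.single H K f)).comp (grade R M K).subtype).codRestrict _
    (fun x => mem_grade.2 (by
      change MackeyAlgebra.indEl (le_refl H) • (MackeyAlgebra.single H K f • (x : M)) =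
        MackeyAlgebra.single H K f • (x : M)
      rw [← mul_smul, MackeyAlgebra.indEl_self_mul_single]))

variable (R M) in
/-- `R^H_K : I^H_H M → I^K_K M`. -/
def gradeRes {K H : Subgroup G} (h : K ≤ H) : grade R M H →ₗ[R] grade R M K :=
  gradeMul M (Omega.res (X := orb R K) (Y := orb R H) (proj h))

variable (R M) in
/-- `I^H_K : I^K_K M → I^H_H M`. -/
def gradeInd {K H : Subgroup G} (h : K ≤ H) : grade R M K →ₗ[R] grade R M H :=
  gradeMul M (Omega.tr (X := orb R K) (Y := orb R H) (proj h))

variable (R M) in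
/-- `C_{g,H} : I^H_H M → I^{ᵍH}_{ᵍH} M`. -/
def gradeCon (g : G) (H : Subgroup G) : grade R M H →ₗ[R] grade R M (conj g H) :=
  gradeMul M (Omega.tr (X := orb R H) (Y := orb R (conj g H)) (cmap g H))

theorem coe_gradeRes {K H : Subgroup G} (h : K ≤ H) (x : grade R M H) :
    (gradeRes R M h x : M) = (MackeyAlgebra.resEl h : MackeyAlgebra R G) • (x : M) := rfl

theorem coe_gradeInd {K H : Subgroup G} (h : K ≤ H) (x : grade R M K) :
    (gradeInd R M h x : M) = (MackeyAlgebra.indEl h : MackeyAlgebra R G) • (x : M) := rfl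

theorem coe_gradeCon (g : G) (H : Subgroup G) (x : grade R M H) :
    (gradeCon R M g H x : M) = (MackeyAlgebra.conEl g H : MackeyAlgebra R G) • (x : M) := rfl

/-- A map of `μ_R(G)`-modules preserves grades. -/
def gradeMap {M' : Type*} [AddCommGroup M'] [Module R M'] [Module (MackeyAlgebra R G) M']
    [IsScalarTower R (MackeyAlgebra R G) M'] (f : M →ₗ[MackeyAlgebra R G] M') (H : Subgroup G) :
    grade R M H →ₗ[R] grade R M' H :=
  ((f.restrictScalars R).comp (grade R M H).subtype).codRestrict _
    (fun x => mem_grade.2 (by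
      change MackeyAlgebra.indEl (le_refl H) • f (x : M) = f (x : M)
      rw [← map_smul, mem_grade.1 x.2]))

end Grade

/-- Strict chains of subgroups `K₀ < K₁ < ⋯ < Kₙ = H` (`n ≥ 0`) ending in `H`. -/
inductive SubChain {G : Type u} [Group G] : Subgroup G → Type u
  | base (H : Subgroup G) : SubChain H
  | step {K H : Subgroup G} (h : K < H) (c : SubChain K) : SubChain H

/-- The smallest member `K₀` of a chain. -/
def SubChain.bot : {H : Subgroup G} → SubChain H → Subgroup G
  | _, .base H => H
  | _, .step _ c => c.bot

/-- For subgroups `J`, `K ≤ H`, the set of double cosets `J \ H / K`. -/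
abbrev DCos (J H K : Subgroup G) : Type u :=
  DoubleCoset.Quotient (J.subgroupOf H : Set H) (K.subgroupOf H : Set H)

/-- A chosen representative of a double coset in `J \ H / K`. -/
def DCos.rep {J H K : Subgroup G} (q : DCos J H K) : G := ((Quotient.out q : H) : G)

instance [Finite G] (J H K : Subgroup G) : Fintype (DCos J H K) :=
  haveI : Finite (DCos J H K) := Quotient.finite _
  Fintype.ofFinite _

/-- `ᵍ(K ∩ Jᵍ) ≤ J`, where `Jᵍ = g⁻¹ J g`.  (In fact `ᵍ(K ∩ Jᵍ) = ᵍK ∩ J`.) -/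
theorem conj_inf_le (g : G) (K J : Subgroup G) : conj g (K ⊓ conj g⁻¹ J) ≤ J := by
  intro x hx
  have h := (mem_conj.1 (Subgroup.mem_inf.1 (mem_conj.1 hx)).2)
  simpa [mul_assoc] using h

section Box

variable [Finite G] (R) (M : Type*) [AddCommGroup M] [Module R M] [Module (MackeyAlgebra R G) M]
  [IsScalarTower R (MackeyAlgebra R G) M] (N : Type*) [AddCommGroup N] [Module R N]
  [Module (MackeyAlgebra R G) N] [IsScalarTower R (MackeyAlgebra R G) N]

/-- `(I^H_H M) ⊗_R (I^H_H N)`. -/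
abbrev Tens (H : Subgroup G) := grade R M H ⊗[R] grade R N H

/-- The `R`-module `A_H`, defined inductively by
`A_H = (I^H_H M ⊗ I^H_H N) ⊕ ⨁_{K < H} A_K`.  Unfolding the induction, `A_H` has one summand
`I^{K₀}_{K₀} M ⊗ I^{K₀}_{K₀} N` for each strict chain `K₀ < ⋯ < Kₙ = H`, and this is how it is
encoded; `BoxGrade.recEquiv` is the inductive description. -/
def BoxGrade (H : Subgroup G) := ⨁ c : SubChain H, Tens R M N c.bot

instance (H : Subgroup G) : AddCommGroup (BoxGrade R M N H) :=
  inferInstanceAs (AddCommGroup (⨁ c : SubChain H, Tens R M N c.bot))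

instance (H : Subgroup G) : Module R (BoxGrade R M N H) :=
  inferInstanceAs (Module R (⨁ c : SubChain H, Tens R M N c.bot))

namespace BoxGrade

open Classical in
/-- The inclusion of the summand of `A_H` that belongs to a chain. -/
def inc {H : Subgroup G} (c : SubChain H) : Tens R M N c.bot →ₗ[R] BoxGrade R M N H :=
  DirectSum.lof R (SubChain H) (fun c => Tens R M N c.bot) c

open Classical in
/-- The map out of `A_H` given by maps on the summands. -/
def lift {H : Subgroup G} {Q : Type*} [AddCommGroup Q] [Module R Q]
    (φ : ∀ c : SubChain H, Tens R M N c.bot →ₗ[R] Q) : BoxGrade R M N H →ₗ[R] Q :=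
  DirectSum.toModule R (SubChain H) Q φ

theorem lift_inc {H : Subgroup G} {Q : Type*} [AddCommGroup Q] [Module R Q]
    (φ : ∀ c : SubChain H, Tens R M N c.bot →ₗ[R] Q) (c : SubChain H) (x : Tens R M N c.bot) :
    lift R M N φ (inc R M N c x) = φ c x := by
  classical
  exact DirectSum.toModule_lof R (M := fun c : SubChain H => Tens R M N c.bot) (φ := φ) c x

theorem hom_ext {H : Subgroup G} {Q : Type*} [AddCommGroup Q] [Module R Q]
    {f g : BoxGrade R M N H →ₗ[R] Q} (h : ∀ c x, f (inc R M N c x) = g (inc R M N c x)) :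
    f = g := by
  classical
  exact DirectSum.linearMap_ext R fun c => LinearMap.ext (h c)

/-- The inclusion of the first summand `I^H_H M ⊗ I^H_H N` of `A_H`. -/
def first (H : Subgroup G) : Tens R M N H →ₗ[R] BoxGrade R M N H :=
  inc R M N (SubChain.base H)

/-- For `K < H`, the inclusion of the summand `A_K` of `A_H`. -/
def up {K H : Subgroup G} (h : K < H) : BoxGrade R M N K →ₗ[R] BoxGrade R M N H :=
  lift R M N fun c => inc R M N (SubChain.step h c)

theorem up_inc {K H : Subgroup G} (h : K < H) (c : SubChain K) (x : Tens R M N c.bot) :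
    up R M N h (inc R M N c x) = inc R M N (SubChain.step h c) x :=
  lift_inc R M N _ c x

/-- `⨁_{K < H} A_K`. -/
abbrev Proper (H : Subgroup G) := ⨁ K : {K : Subgroup G // K < H}, BoxGrade R M N K.1

open Classical in
/-- The summand `A_K` of `⨁_{K < H} A_K`. -/
def properInc {K H : Subgroup G} (h : K < H) : BoxGrade R M N K →ₗ[R] Proper R M N H :=
  DirectSum.lof R {K : Subgroup G // K < H} (fun K => BoxGrade R M N K.1) ⟨K, h⟩

open Classical in
/-- The inclusions of the `A_K`, `K < H`, in `A_H`. -/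
def properMap (H : Subgroup G) : Proper R M N H →ₗ[R] BoxGrade R M N H :=
  DirectSum.toModule R {K : Subgroup G // K < H} (BoxGrade R M N H) fun K => up R M N K.2

theorem properMap_inc {K H : Subgroup G} (h : K < H) (x : BoxGrade R M N K) :
    properMap R M N H (properInc R M N h x) = up R M N h x := by
  classical
  exact DirectSum.toModule_lof R (M := fun K : {K : Subgroup G // K < H} => BoxGrade R M N K.1)
    (φ := fun K => up R M N K.2) ⟨K, h⟩ x

/-- The components of `recEquiv`. -/
def recMap : {H : Subgroup G} → (c : SubChain H) →
    (Tens R M N c.bot →ₗ[R] Tens R M N H × Proper R M N H)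
  | H, .base _ => LinearMap.inl R (Tens R M N H) (Proper R M N H)
  | H, .step h c => LinearMap.inr R (Tens R M N H) (Proper R M N H) ∘ₗ properInc R M N h ∘ₗ
      inc R M N c

/-- The inductive description `A_H ≅ (I^H_H M ⊗ I^H_H N) ⊕ ⨁_{K < H} A_K`. -/
def recEquiv (H : Subgroup G) : BoxGrade R M N H ≃ₗ[R] Tens R M N H × Proper R M N H :=
  LinearEquiv.ofLinearMap
    (lift R M N fun c => recMap R M N c)
    (LinearMap.coprod (first R M N H) (properMap R M N H))
    (by
      refine LinearMap.prod_ext (LinearMap.ext fun x => ?_) ?_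
      · change lift R M N _ (LinearMap.coprod (first R M N H) (properMap R M N H) (x, 0)) = (x, 0)
        rw [LinearMap.coprod_apply, map_zero, add_zero]
        exact lift_inc R M N _ (SubChain.base H) x
      · classical
        refine DirectSum.linearMap_ext R fun K => hom_ext R M N fun c x => ?_
        change lift R M N _ (LinearMap.coprod (first R M N H) (properMap R M N H)
          (0, properInc R M N K.2 (inc R M N c x))) = (0, properInc R M N K.2 (inc R M N c x))
        rw [LinearMap.coprod_apply, map_zero, zero_add, properMap_inc, up_inc]
        exact lift_inc R M N _ (SubChain.step K.2 c) x)
    (by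
      refine hom_ext R M N fun c x => ?_
      rw [LinearMap.comp_apply, lift_inc]
      cases c with
      | base =>
        change LinearMap.coprod (first R M N H) (properMap R M N H) (x, 0) = first R M N H x
        rw [LinearMap.coprod_apply, map_zero, add_zero]
      | step h c =>
        change LinearMap.coprod (first R M N H) (properMap R M N H)
          (0, properInc R M N h (inc R M N c x)) = inc R M N (SubChain.step h c) x
        rw [LinearMap.coprod_apply, map_zero, zero_add, properMap_inc]
        exact up_inc R M N h c x)

open Classical in
/-- `I^H_K` on the grade `K`: the identity if `K = H`, and the inclusion of `A_K` in `A_H` if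
`K < H`. -/
def ind {K H : Subgroup G} (h : K ≤ H) : BoxGrade R M N K →ₗ[R] BoxGrade R M N H :=
  if e : K = H then e ▸ LinearMap.id else up R M N (lt_of_le_of_ne h e)

/-- `C_{g,H}` on the summands of the grade `H`:
`C_{g,H}(m ⊗ n) = C_{g,H} m ⊗ C_{g,H} n` and `C_{g,H} I^H_K x = I^{ᵍH}_{ᵍK} C_{g,K} x`. -/
def conChain (g : G) : {H : Subgroup G} → (c : SubChain H) →
    (Tens R M N c.bot →ₗ[R] BoxGrade R M N (conj g H))
  | _, .base H => first R M N (conj g H) ∘ₗ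
      TensorProduct.map (gradeCon R M g H) (gradeCon R N g H)
  | _, .step h c => up R M N (conj_lt g h) ∘ₗ conChain g c

/-- `C_{g,H}` on the grade `H`. -/
def con (g : G) (H : Subgroup G) : BoxGrade R M N H →ₗ[R] BoxGrade R M N (conj g H) :=
  lift R M N fun c => conChain R M N g c

/-- `R^H_J` on the summands of the grade `H`: `R^H_J (m ⊗ n) = R^H_J m ⊗ R^H_J n` and
`R^H_J I^H_K x = ∑_{g ∈ [J\H/K]} I^J_{ᵍK ∩ J} C_g R^K_{K ∩ Jᵍ} x`. -/
def resChain : {H : Subgroup G} → (c : SubChain H) → (J : Subgroup G) → J ≤ H →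
    (Tens R M N c.bot →ₗ[R] BoxGrade R M N J)
  | _, .base _, J, hJ => first R M N J ∘ₗ
      TensorProduct.map (gradeRes R M hJ) (gradeRes R N hJ)
  | H, .step (K := K) _ c, J, _ => ∑ q : DCos J H K,
      ind R M N (conj_inf_le q.rep K J) ∘ₗ con R M N q.rep (K ⊓ conj q.rep⁻¹ J) ∘ₗ
        resChain c (K ⊓ conj q.rep⁻¹ J) inf_le_left

/-- `R^H_J` on the grade `H`. -/
def res {J H : Subgroup G} (h : J ≤ H) : BoxGrade R M N H →ₗ[R] BoxGrade R M N J :=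
  lift R M N fun c => resChain R M N c J h

end BoxGrade

/-- `A = ⨁_{H ≤ G} A_H`.  As `G` has finitely many subgroups, the direct sum is a product. -/
def BoxSum := ∀ H : Subgroup G, BoxGrade R M N H

instance : AddCommGroup (BoxSum (G := G) R M N) :=
  inferInstanceAs (AddCommGroup (∀ H : Subgroup G, BoxGrade R M N H))

instance : Module R (BoxSum (G := G) R M N) :=
  inferInstanceAs (Module R (∀ H : Subgroup G, BoxGrade R M N H))

open Classical in
/-- The inclusion of the grade `H` of `A`. -/
def BoxSum.inc (H : Subgroup G) : BoxGrade R M N H →ₗ[R] BoxSum (G := G) R M N :=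
  LinearMap.single R (fun H : Subgroup G => BoxGrade R M N H) H

/-- The projection to the grade `H` of `A`. -/
def BoxSum.pr (H : Subgroup G) : BoxSum (G := G) R M N →ₗ[R] BoxGrade R M N H :=
  LinearMap.proj H

/-- The operators `R^H_K`, `I^H_K` and `C_{g,H}` on `A`; they vanish on all grades but one. -/
def BoxSum.op : Gen G → Module.End R (BoxSum (G := G) R M N)
  | .res K H h => BoxSum.inc R M N K ∘ₗ BoxGrade.res R M N h ∘ₗ BoxSum.pr R M N H
  | .ind K H h => BoxSum.inc R M N H ∘ₗ BoxGrade.ind R M N h ∘ₗ BoxSum.pr R M N K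
  | .con g H => BoxSum.inc R M N (conj g H) ∘ₗ BoxGrade.con R M N g H ∘ₗ BoxSum.pr R M N H

/-- The action on `A` of the noncommutative polynomials in the symbols. -/
def BoxSum.act : FreeAlgebra R (Gen G) →ₐ[R] Module.End R (BoxSum (G := G) R M N) :=
  FreeAlgebra.lift R (BoxSum.op R M N)

/-- The Frobenius reciprocity elements `a ⊗ I^H_K b - I^H_K (R^H_K a ⊗ b)` and
`I^H_K c ⊗ d - I^H_K (c ⊗ R^H_K d)`, for `K < H`. -/
inductive BoxSum.IsFrob : BoxSum (G := G) R M N → Prop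
  | right {K H : Subgroup G} (h : K < H) (a : grade R M H) (b : grade R N K) : BoxSum.IsFrob
      (BoxSum.inc R M N H (BoxGrade.first R M N H (a ⊗ₜ gradeInd R N h.le b)) -
        BoxSum.op R M N (.ind K H h.le)
          (BoxSum.inc R M N K (BoxGrade.first R M N K (gradeRes R M h.le a ⊗ₜ b))))
  | left {K H : Subgroup G} (h : K < H) (c : grade R M K) (d : grade R N H) : BoxSum.IsFrob
      (BoxSum.inc R M N H (BoxGrade.first R M N H (gradeInd R M h.le c ⊗ₜ d)) -
        BoxSum.op R M N (.ind K H h.le)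
          (BoxSum.inc R M N K (BoxGrade.first R M N K (c ⊗ₜ gradeRes R N h.le d))))

/-- The Frobenius reciprocity submodule: the smallest submodule of `A` which contains the
Frobenius reciprocity elements and is stable under all `R^H_K`, `I^H_K`, `C_{g,H}`. -/
def BoxSum.FR : Submodule R (BoxSum (G := G) R M N) :=
  sInf {S | (∀ x, BoxSum.IsFrob R M N x → x ∈ S) ∧
    ∀ (s : Gen G) (x), x ∈ S → BoxSum.op R M N s x ∈ S}

/-- The submodule of `A` spanned by all `p · x` where `x ∈ A` and `p` is a relation between the
elements `R^H_K`, `I^H_K`, `C_{g,H}` of `μ_R(G)`.  The operators on `A` satisfy such a relation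
only modulo this submodule: for instance `C_{h,H} = I^H_H` in `μ_R(G)` for `h ∈ H`, but `C_{h,H}`
moves the summand `A_K` of `A_H` to the summand `A_{ʰK}`, and `I^H_K I^K_J = I^H_J`, but
`I^H_K I^K_J x` and `I^H_J x` lie in different summands of `A_H`. -/
def BoxSum.Rel : Submodule R (BoxSum (G := G) R M N) :=
  Submodule.span R {y | ∃ (p : FreeAlgebra R (Gen G)) (x : BoxSum (G := G) R M N),
    evalGen R G p = 0 ∧ BoxSum.act R M N p x = y}

theorem BoxSum.act_ι (s : Gen G) :
    BoxSum.act R M N (FreeAlgebra.ι R s) = BoxSum.op R M N s := by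
  simp [BoxSum.act]

theorem BoxSum.op_mem_FR (s : Gen G) {x : BoxSum (G := G) R M N} (hx : x ∈ BoxSum.FR R M N) :
    BoxSum.op R M N s x ∈ BoxSum.FR R M N := by
  rw [BoxSum.FR, Submodule.mem_sInf] at hx ⊢
  intro S hS
  exact hS.2 s x (hx S hS)

theorem BoxSum.op_mem_Rel (s : Gen G) {x : BoxSum (G := G) R M N} (hx : x ∈ BoxSum.Rel R M N) :
    BoxSum.op R M N s x ∈ BoxSum.Rel R M N := by
  have h : BoxSum.Rel R M N ≤ (BoxSum.Rel R M N).comap (BoxSum.op R M N s) := by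
    refine Submodule.span_le.2 ?_
    rintro y ⟨p, x, hp, rfl⟩
    refine Submodule.subset_span ⟨FreeAlgebra.ι R s * p, x, ?_, ?_⟩
    · rw [map_mul, hp, mul_zero]
    · rw [map_mul, BoxSum.act_ι]
      rfl
  exact h hx

/-- The submodule of `A` that is divided out. -/
def BoxSum.ker : Submodule R (BoxSum (G := G) R M N) := BoxSum.FR R M N ⊔ BoxSum.Rel R M N

theorem BoxSum.ker_le_comap (s : Gen G) :
    BoxSum.ker R M N ≤ (BoxSum.ker R M N).comap (BoxSum.op R M N s) :=
  sup_le (fun _ hx => Submodule.mem_sup_left (BoxSum.op_mem_FR R M N s hx))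
    (fun _ hx => Submodule.mem_sup_right (BoxSum.op_mem_Rel R M N s hx))

/-- The box product `M □ N` of left `μ_R(G)`-modules: the quotient of `A` by the Frobenius
reciprocity submodule `FR`, made a `μ_R(G)`-module by dividing out `Rel`. -/
def Box : Type _ := BoxSum (G := G) R M N ⧸ BoxSum.ker R M N

instance : AddCommGroup (Box (G := G) R M N) :=
  inferInstanceAs (AddCommGroup (BoxSum (G := G) R M N ⧸ BoxSum.ker R M N))

instance : Module R (Box (G := G) R M N) :=
  inferInstanceAs (Module R (BoxSum (G := G) R M N ⧸ BoxSum.ker R M N))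

/-- The quotient map `A → M □ N`. -/
def Box.mk : BoxSum (G := G) R M N →ₗ[R] Box (G := G) R M N := (BoxSum.ker R M N).mkQ

theorem Box.mk_surjective : Function.Surjective (Box.mk (G := G) R M N) :=
  Submodule.mkQ_surjective _

theorem Box.ker_mk : LinearMap.ker (Box.mk (G := G) R M N) = BoxSum.ker R M N :=
  Submodule.ker_mkQ _

/-- The operators on `M □ N` induced by those on `A`. -/
def Box.op (s : Gen G) : Module.End R (Box (G := G) R M N) :=
  (BoxSum.ker R M N).mapQ (BoxSum.ker R M N) (BoxSum.op R M N s) (BoxSum.ker_le_comap R M N s)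

theorem Box.op_mk (s : Gen G) (x : BoxSum (G := G) R M N) :
    Box.op R M N s (Box.mk R M N x) = Box.mk R M N (BoxSum.op R M N s x) := rfl

/-- The action on `M □ N` of the noncommutative polynomials in the symbols. -/
def Box.act : FreeAlgebra R (Gen G) →ₐ[R] Module.End R (Box (G := G) R M N) :=
  FreeAlgebra.lift R (Box.op R M N)

theorem Box.act_mk (p : FreeAlgebra R (Gen G)) (x : BoxSum (G := G) R M N) :
    Box.act R M N p (Box.mk R M N x) = Box.mk R M N (BoxSum.act R M N p x) := by
  induction p using FreeAlgebra.induction generalizing x with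
  | grade0 r => simp only [AlgHom.commutes, Module.algebraMap_end_apply, map_smul]
  | grade1 s => simp only [Box.act, BoxSum.act, FreeAlgebra.lift_ι_apply, Box.op_mk]
  | mul a b ha hb => simp only [map_mul, Module.End.mul_apply, ha, hb]
  | add a b ha hb => simp only [map_add, LinearMap.add_apply, ha, hb]

theorem Box.act_eq_zero (p : FreeAlgebra R (Gen G)) (hp : evalGen R G p = 0) :
    Box.act R M N p = 0 := by
  ext y
  obtain ⟨x, rfl⟩ := Box.mk_surjective R M N y
  rw [Box.act_mk]
  exact (Submodule.Quotient.mk_eq_zero _).2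
    (Submodule.mem_sup_right (Submodule.subset_span ⟨p, x, hp, rfl⟩))

/-- The action of the Mackey algebra on `M □ N`. -/
def Box.toEnd : MackeyAlgebra R G →+* Module.End R (Box (G := G) R M N) :=
  RingHom.liftOfSurjective (evalGen R G).toRingHom evalGen_surjective
    ⟨(Box.act R M N).toRingHom, fun p hp => Box.act_eq_zero R M N p hp⟩

theorem Box.toEnd_evalGen (p : FreeAlgebra R (Gen G)) :
    Box.toEnd R M N (evalGen R G p) = Box.act R M N p :=
  RingHom.liftOfRightInverse_comp_apply (evalGen R G).toRingHom _ _
    ⟨(Box.act R M N).toRingHom, fun p hp => Box.act_eq_zero R M N p hp⟩ p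

instance : Module (MackeyAlgebra R G) (Box (G := G) R M N) :=
  Module.compHom _ (Box.toEnd R M N)

theorem Box.evalGen_smul_mk (p : FreeAlgebra R (Gen G)) (x : BoxSum (G := G) R M N) :
    evalGen R G p • Box.mk R M N x = Box.mk R M N (BoxSum.act R M N p x) := by
  rw [← Box.act_mk, ← Box.toEnd_evalGen]
  rfl

/-- `R^H_K`, `I^H_K` and `C_{g,H}` act on `M □ N` through the operators on `A`. -/
theorem Box.elem_smul_mk (s : Gen G) (x : BoxSum (G := G) R M N) :
    s.elem R • Box.mk R M N x = Box.mk R M N (BoxSum.op R M N s x) := by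
  rw [← evalGen_ι, Box.evalGen_smul_mk, BoxSum.act_ι]

instance : IsScalarTower R (MackeyAlgebra R G) (Box (G := G) R M N) :=
  IsScalarTower.of_algebraMap_smul fun r y => by
    obtain ⟨x, rfl⟩ := Box.mk_surjective R M N y
    rw [← (evalGen R G).commutes, Box.evalGen_smul_mk, AlgHom.commutes,
      Module.algebraMap_end_apply, map_smul]

end Box

/-! ### Functoriality of the box product -/

section BoxMap

variable [Finite G] {M : Type*} [AddCommGroup M] [Module R M] [Module (MackeyAlgebra R G) M]
  [IsScalarTower R (MackeyAlgebra R G) M] {N : Type*} [AddCommGroup N] [Module R N]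
  [Module (MackeyAlgebra R G) N] [IsScalarTower R (MackeyAlgebra R G) N]
  {M' : Type*} [AddCommGroup M'] [Module R M'] [Module (MackeyAlgebra R G) M']
  [IsScalarTower R (MackeyAlgebra R G) M'] {N' : Type*} [AddCommGroup N'] [Module R N']
  [Module (MackeyAlgebra R G) N'] [IsScalarTower R (MackeyAlgebra R G) N']
  (f : M →ₗ[MackeyAlgebra R G] M') (g : N →ₗ[MackeyAlgebra R G] N')

theorem gradeMap_gradeMul {H K : Subgroup G} (a : orb R H ⟶ orb R K) (x : grade R M K) :
    gradeMap f H (gradeMul M a x) = gradeMul M' a (gradeMap f K x) :=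
  Subtype.ext (map_smul f (MackeyAlgebra.single H K a) (x : M))

/-- `f ⊗ g` on `I^H_H M ⊗ I^H_H N`. -/
def tensMap (H : Subgroup G) : Tens R M N H →ₗ[R] Tens R M' N' H :=
  TensorProduct.map (gradeMap f H) (gradeMap g H)

theorem tensMap_map {H K : Subgroup G} (a : orb R H ⟶ orb R K) (x : Tens R M N K) :
    tensMap f g H (TensorProduct.map (gradeMul M a) (gradeMul N a) x) =
      TensorProduct.map (gradeMul M' a) (gradeMul N' a) (tensMap f g K x) := by
  have h : tensMap f g H ∘ₗ TensorProduct.map (gradeMul M a) (gradeMul N a) =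
      TensorProduct.map (gradeMul M' a) (gradeMul N' a) ∘ₗ tensMap f g K := by
    refine TensorProduct.ext' fun m n => ?_
    simp [tensMap, gradeMap_gradeMul]
  exact LinearMap.congr_fun h x

/-- `f` and `g` induce a map on `A_H`, summand by summand. -/
def BoxGrade.map (H : Subgroup G) : BoxGrade R M N H →ₗ[R] BoxGrade R M' N' H :=
  BoxGrade.lift R M N fun c => BoxGrade.inc R M' N' c ∘ₗ tensMap f g c.bot

theorem BoxGrade.map_inc {H : Subgroup G} (c : SubChain H) (x : Tens R M N c.bot) :
    BoxGrade.map f g H (BoxGrade.inc R M N c x) =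
      BoxGrade.inc R M' N' c (tensMap f g c.bot x) :=
  BoxGrade.lift_inc R M N _ c x

theorem BoxGrade.map_first {H : Subgroup G} (x : Tens R M N H) :
    BoxGrade.map f g H (BoxGrade.first R M N H x) =
      BoxGrade.first R M' N' H (tensMap f g H x) :=
  BoxGrade.map_inc f g (SubChain.base H) x

theorem BoxGrade.map_up {K H : Subgroup G} (h : K < H) (x : BoxGrade R M N K) :
    BoxGrade.map f g H (BoxGrade.up R M N h x) =
      BoxGrade.up R M' N' h (BoxGrade.map f g K x) := by
  have e : BoxGrade.map f g H ∘ₗ BoxGrade.up R M N h =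
      BoxGrade.up R M' N' h ∘ₗ BoxGrade.map f g K := by
    refine BoxGrade.hom_ext R M N fun c x => ?_
    rw [LinearMap.comp_apply, LinearMap.comp_apply, BoxGrade.map_inc, BoxGrade.up_inc,
      BoxGrade.up_inc]
    exact BoxGrade.map_inc f g (SubChain.step h c) x
  exact LinearMap.congr_fun e x

theorem BoxGrade.map_ind {K H : Subgroup G} (h : K ≤ H) (x : BoxGrade R M N K) :
    BoxGrade.map f g H (BoxGrade.ind R M N h x) =
      BoxGrade.ind R M' N' h (BoxGrade.map f g K x) := by
  unfold BoxGrade.ind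
  by_cases e : K = H
  · subst e
    simp
  · simp only [e, dif_neg, not_false_eq_true]
    exact BoxGrade.map_up f g _ x

theorem BoxGrade.map_conChain (k : G) {H : Subgroup G} (c : SubChain H) (x : Tens R M N c.bot) :
    BoxGrade.map f g (conj k H) (BoxGrade.conChain R M N k c x) =
      BoxGrade.conChain R M' N' k c (tensMap f g c.bot x) := by
  induction c with
  | base H =>
    refine (BoxGrade.map_first f g _).trans ?_
    exact congrArg _ (tensMap_map f g _ x)
  | step h c ih =>
    refine (BoxGrade.map_up f g _ _).trans ?_
    exact congrArg _ (ih x)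

theorem BoxGrade.map_con (k : G) (H : Subgroup G) (x : BoxGrade R M N H) :
    BoxGrade.map f g (conj k H) (BoxGrade.con R M N k H x) =
      BoxGrade.con R M' N' k H (BoxGrade.map f g H x) := by
  have e : BoxGrade.map f g (conj k H) ∘ₗ BoxGrade.con R M N k H =
      BoxGrade.con R M' N' k H ∘ₗ BoxGrade.map f g H := by
    refine BoxGrade.hom_ext R M N fun c x => ?_
    rw [LinearMap.comp_apply, LinearMap.comp_apply, BoxGrade.map_inc, BoxGrade.con,
      BoxGrade.con, BoxGrade.lift_inc, BoxGrade.lift_inc, BoxGrade.map_conChain]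
  exact LinearMap.congr_fun e x

theorem BoxGrade.map_resChain {H : Subgroup G} (c : SubChain H) (J : Subgroup G) (hJ : J ≤ H)
    (x : Tens R M N c.bot) :
    BoxGrade.map f g J (BoxGrade.resChain R M N c J hJ x) =
      BoxGrade.resChain R M' N' c J hJ (tensMap f g c.bot x) := by
  induction c generalizing J with
  | base H =>
    refine (BoxGrade.map_first f g _).trans ?_
    exact congrArg _ (tensMap_map f g _ x)
  | step h c ih =>
    simp only [BoxGrade.resChain]
    rw [LinearMap.sum_apply, LinearMap.sum_apply, map_sum]
    refine Finset.sum_congr rfl fun q _ => ?_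
    refine (BoxGrade.map_ind f g _ _).trans ?_
    refine congrArg _ ((BoxGrade.map_con f g _ _ _).trans ?_)
    exact congrArg _ (ih _ _ x)

theorem BoxGrade.map_res {J H : Subgroup G} (h : J ≤ H) (x : BoxGrade R M N H) :
    BoxGrade.map f g J (BoxGrade.res R M N h x) =
      BoxGrade.res R M' N' h (BoxGrade.map f g H x) := by
  have e : BoxGrade.map f g J ∘ₗ BoxGrade.res R M N h =
      BoxGrade.res R M' N' h ∘ₗ BoxGrade.map f g H := by
    refine BoxGrade.hom_ext R M N fun c x => ?_
    rw [LinearMap.comp_apply, LinearMap.comp_apply, BoxGrade.map_inc, BoxGrade.res,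
      BoxGrade.res, BoxGrade.lift_inc, BoxGrade.lift_inc, BoxGrade.map_resChain]
  exact LinearMap.congr_fun e x

/-- `f` and `g` induce a map on `A`, grade by grade. -/
def BoxSum.map : BoxSum (G := G) R M N →ₗ[R] BoxSum (G := G) R M' N' :=
  LinearMap.pi (φ := fun H : Subgroup G => BoxGrade R M' N' H)
    fun H => BoxGrade.map f g H ∘ₗ BoxSum.pr R M N H

theorem BoxSum.map_inc (H : Subgroup G) (x : BoxGrade R M N H) :
    BoxSum.map f g (BoxSum.inc R M N H x) = BoxSum.inc R M' N' H (BoxGrade.map f g H x) := by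
  classical
  refine funext fun K => ?_
  change BoxGrade.map f g K (Pi.single H x K : BoxGrade R M N K) =
    (Pi.single H (BoxGrade.map f g H x) K : BoxGrade R M' N' K)
  by_cases h : K = H
  · subst h
    simp
  · simp [h]

theorem BoxSum.map_op (s : Gen G) (x : BoxSum (G := G) R M N) :
    BoxSum.map f g (BoxSum.op R M N s x) = BoxSum.op R M' N' s (BoxSum.map f g x) := by
  cases s with
  | res K H h =>
    refine (BoxSum.map_inc f g K _).trans ?_
    exact congrArg _ (BoxGrade.map_res f g h _)
  | ind K H h =>
    refine (BoxSum.map_inc f g H _).trans ?_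
    exact congrArg _ (BoxGrade.map_ind f g h _)
  | con k H =>
    refine (BoxSum.map_inc f g _ _).trans ?_
    exact congrArg _ (BoxGrade.map_con f g k H _)

theorem BoxSum.map_act (p : FreeAlgebra R (Gen G)) (x : BoxSum (G := G) R M N) :
    BoxSum.map f g (BoxSum.act R M N p x) = BoxSum.act R M' N' p (BoxSum.map f g x) := by
  induction p using FreeAlgebra.induction generalizing x with
  | grade0 r => simp only [AlgHom.commutes, Module.algebraMap_end_apply, map_smul]
  | grade1 s => rw [BoxSum.act_ι, BoxSum.act_ι, BoxSum.map_op]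
  | mul a b ha hb => simp only [map_mul, Module.End.mul_apply, ha, hb]
  | add a b ha hb => simp only [map_add, LinearMap.add_apply, ha, hb]

theorem BoxSum.frob_mem_FR {x : BoxSum (G := G) R M N} (hx : BoxSum.IsFrob R M N x) :
    x ∈ BoxSum.FR R M N := by
  rw [BoxSum.FR, Submodule.mem_sInf]
  exact fun S hS => hS.1 x hx

theorem BoxSum.map_frob {x : BoxSum (G := G) R M N} (hx : BoxSum.IsFrob R M N x) :
    BoxSum.IsFrob R M' N' (BoxSum.map f g x) := by
  cases hx with
  | right h a b =>
    rw [map_sub, BoxSum.map_op, BoxSum.map_inc, BoxSum.map_inc, BoxGrade.map_first,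
      BoxGrade.map_first]
    have h1 := BoxSum.IsFrob.right (R := R) h (gradeMap f _ a) (gradeMap g _ b)
    rw [gradeInd, gradeRes, ← gradeMap_gradeMul, ← gradeMap_gradeMul] at h1
    exact h1
  | left h a b =>
    rw [map_sub, BoxSum.map_op, BoxSum.map_inc, BoxSum.map_inc, BoxGrade.map_first,
      BoxGrade.map_first]
    have h1 := BoxSum.IsFrob.left (R := R) h (gradeMap f _ a) (gradeMap g _ b)
    rw [gradeInd, gradeRes, ← gradeMap_gradeMul, ← gradeMap_gradeMul] at h1
    exact h1

theorem BoxSum.ker_le_comap_map :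
    BoxSum.ker R M N ≤ (BoxSum.ker (G := G) R M' N').comap (BoxSum.map f g) := by
  refine sup_le ?_ ?_
  · refine sInf_le ⟨fun x hx => Submodule.mem_sup_left
      (BoxSum.frob_mem_FR (BoxSum.map_frob f g hx)), fun s x hx => ?_⟩
    rw [Submodule.mem_comap, BoxSum.map_op]
    exact BoxSum.ker_le_comap R M' N' s hx
  · refine Submodule.span_le.2 ?_
    rintro y ⟨p, x, hp, rfl⟩
    exact Submodule.mem_sup_right (Submodule.subset_span ⟨p, _, hp, (BoxSum.map_act f g p x).symm⟩)

/-- The `R`-linear map underlying `Box.map`. -/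
def Box.mapAux : Box (G := G) R M N →ₗ[R] Box (G := G) R M' N' :=
  (BoxSum.ker R M N).mapQ (BoxSum.ker R M' N') (BoxSum.map f g) (BoxSum.ker_le_comap_map f g)

theorem Box.mapAux_mk (x : BoxSum (G := G) R M N) :
    Box.mapAux f g (Box.mk R M N x) = Box.mk R M' N' (BoxSum.map f g x) := rfl

/-- The map `f □ g : M □ N → M' □ N'` induced by `μ_R(G)`-module maps `f` and `g`. -/
def Box.map : Box (G := G) R M N →ₗ[MackeyAlgebra R G] Box (G := G) R M' N' where
  toFun := Box.mapAux f g
  map_add' := map_add _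
  map_smul' a y := by
    obtain ⟨p, rfl⟩ := evalGen_surjective a
    obtain ⟨x, rfl⟩ := Box.mk_surjective R M N y
    rw [Box.evalGen_smul_mk, Box.mapAux_mk, Box.mapAux_mk, BoxSum.map_act, RingHom.id_apply,
      Box.evalGen_smul_mk]

end BoxMap

/-! ### Mackey functors, Dress pairings, and the functor `Φ` -/

/-- A Mackey functor: an `R`-additive functor `Ω_R(G)ᵒᵖ → R`-mod. -/
structure MackeyFunctor (R : Type w) [CommRing R] (G : Type u) [Group G] where
  /-- the underlying functor -/
  F : (Omega R G)ᵒᵖ ⥤ ModuleCat.{v} R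
  map_add : ∀ {X Y : Omega R G} (f g : X ⟶ Y), F.map (f + g).op = F.map f.op + F.map g.op
  map_smul : ∀ {X Y : Omega R G} (r : R) (f : X ⟶ Y), F.map (r • f).op = r • F.map f.op

namespace MackeyFunctor

variable (M : MackeyFunctor.{u, v, w} R G)

/-- The value `M(X)` at a finite `G`-set `X`. -/
abbrev val (X : Omega R G) : ModuleCat.{v} R := M.F.obj (op X)

/-- The map `M(Y) → M(X)` given by a morphism `X ⟶ Y` of `Ω_R(G)`. -/
def ap {X Y : Omega R G} (f : X ⟶ Y) : M.val Y →ₗ[R] M.val X := (M.F.map f.op).hom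

/-- The restriction `r_f : M(Y) → M(X)` of a map `f : X → Y` of `G`-sets. -/
def r {X Y : Omega R G} (f : X.gset →[G] Y.gset) : M.val Y →ₗ[R] M.val X := M.ap (Omega.res f)

/-- The transfer `t_f : M(X) → M(Y)` of a map `f : X → Y` of `G`-sets. -/
def t {X Y : Omega R G} (f : X.gset →[G] Y.gset) : M.val X →ₗ[R] M.val Y := M.ap (Omega.tr f)

/-- Morphisms of Mackey functors are natural transformations. -/
abbrev Hom (M N : MackeyFunctor.{u, v, w} R G) := M.F ⟶ N.F

/-- The component at `X` of a morphism of Mackey functors. -/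
def Hom.at {M N : MackeyFunctor.{u, v, w} R G} (φ : M.Hom N) (X : Omega R G) :
    M.val X →ₗ[R] N.val X := (φ.app (op X)).hom

theorem Hom.at_ap {M N : MackeyFunctor.{u, v, w} R G} (φ : M.Hom N) {X Y : Omega R G}
    (f : X ⟶ Y) (x : M.val Y) : φ.at X (M.ap f x) = N.ap f (φ.at Y x) :=
  LinearMap.congr_fun (congrArg ModuleCat.Hom.hom (φ.naturality f.op)) x

theorem ap_id (X : Omega R G) (x : M.val X) : M.ap (𝟙 X) x = x :=
  LinearMap.congr_fun (congrArg ModuleCat.Hom.hom (M.F.map_id (op X))) x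

theorem ap_comp {X Y Z : Omega R G} (f : X ⟶ Y) (g : Y ⟶ Z) (x : M.val Z) :
    M.ap (f ≫ g) x = M.ap f (M.ap g x) :=
  LinearMap.congr_fun (congrArg ModuleCat.Hom.hom (M.F.map_comp g.op f.op)) x

theorem ap_add {X Y : Omega R G} (f g : X ⟶ Y) (x : M.val Y) :
    M.ap (f + g) x = M.ap f x + M.ap g x :=
  LinearMap.congr_fun (congrArg ModuleCat.Hom.hom (M.map_add f g)) x

theorem ap_smul {X Y : Omega R G} (r : R) (f : X ⟶ Y) (x : M.val Y) :
    M.ap (r • f) x = r • M.ap f x :=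
  LinearMap.congr_fun (congrArg ModuleCat.Hom.hom (M.map_smul r f)) x

theorem ap_zero {X Y : Omega R G} (x : M.val Y) : M.ap (0 : X ⟶ Y) x = 0 := by
  have h := M.ap_smul (0 : R) (0 : X ⟶ Y) x
  rwa [zero_smul, zero_smul] at h

theorem ap_sum {X Y : Omega R G} {ι : Type*} (s : Finset ι) (f : ι → (X ⟶ Y)) (x : M.val Y) :
    M.ap (∑ i ∈ s, f i) x = ∑ i ∈ s, M.ap (f i) x := by
  classical
  induction s using Finset.induction_on with
  | empty => simp [ap_zero]
  | insert i s hi ih => rw [Finset.sum_insert hi, Finset.sum_insert hi, ap_add, ih]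

end MackeyFunctor

/-- A Dress pairing from `M` and `N` to `P`. -/
@[ext] structure DressPairing (M N P : MackeyFunctor.{u, v, w} R G) where
  /-- the maps `θ_X : M(X) ⊗ N(X) → P(X)` -/
  θ : ∀ X : Omega R G, M.val X ⊗[R] N.val X →ₗ[R] P.val X
  res : ∀ {X Y : Omega R G} (f : X.gset →[G] Y.gset) (m : M.val Y) (n : N.val Y),
    P.r f (θ Y (m ⊗ₜ n)) = θ X (M.r f m ⊗ₜ N.r f n)
  frob_left : ∀ {X Y : Omega R G} (f : X.gset →[G] Y.gset) (m : M.val X) (n : N.val Y),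
    P.t f (θ X (m ⊗ₜ N.r f n)) = θ Y (M.t f m ⊗ₜ n)
  frob_right : ∀ {X Y : Omega R G} (f : X.gset →[G] Y.gset) (m : M.val Y) (n : N.val X),
    P.t f (θ X (M.r f m ⊗ₜ n)) = θ Y (m ⊗ₜ N.t f n)

/-- Functoriality of Dress pairings: contravariant in `M` and `N`, covariant in `P`. -/
def DressPairing.map {M M' N N' P P' : MackeyFunctor.{u, v, w} R G} (a : M'.Hom M)
    (b : N'.Hom N) (c : P.Hom P') (θ : DressPairing M N P) : DressPairing M' N' P' where
  θ X := c.at X ∘ₗ θ.θ X ∘ₗ TensorProduct.map (a.at X) (b.at X)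
  res f m n := by
    have h := congrArg (c.at _) (θ.res f (a.at _ m) (b.at _ n))
    simp only [MackeyFunctor.r, MackeyFunctor.Hom.at_ap] at h
    simpa [MackeyFunctor.r, MackeyFunctor.Hom.at_ap] using h
  frob_left f m n := by
    have h := congrArg (c.at _) (θ.frob_left f (a.at _ m) (b.at _ n))
    simp only [MackeyFunctor.r, MackeyFunctor.t, MackeyFunctor.Hom.at_ap] at h
    simpa [MackeyFunctor.r, MackeyFunctor.t, MackeyFunctor.Hom.at_ap] using h
  frob_right f m n := by
    have h := congrArg (c.at _) (θ.frob_right f (a.at _ m) (b.at _ n))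
    simp only [MackeyFunctor.r, MackeyFunctor.t, MackeyFunctor.Hom.at_ap] at h
    simpa [MackeyFunctor.r, MackeyFunctor.t, MackeyFunctor.Hom.at_ap] using h

section Phi

variable [Finite G]

/-- `Φ M = ⨁_{H ≤ G} M(G/H)`.  As `G` has finitely many subgroups, the direct sum is a product. -/
def Phi (M : MackeyFunctor.{u, v, w} R G) : Type (max u v) :=
  ∀ H : Subgroup G, M.val (orb R H)

variable (M N P : MackeyFunctor.{u, v, w} R G)

instance : AddCommGroup (Phi M) :=
  inferInstanceAs (AddCommGroup (∀ H : Subgroup G, M.val (orb R H)))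

instance : Module R (Phi M) :=
  inferInstanceAs (Module R (∀ H : Subgroup G, M.val (orb R H)))

/-- A morphism `a : G/H → G/K` in `μ_R(G)` acts by `M(a) : M(G/K) → M(G/H)` on the grade `K` and
by zero on the other grades. -/
instance : SMul (MackeyAlgebra R G) (Phi M) := ⟨fun a x H => ∑ K, M.ap (a H K) (x K)⟩

theorem Phi.smul_app (a : MackeyAlgebra R G) (x : Phi M) (H : Subgroup G) :
    (a • x) H = ∑ K, M.ap (a H K) (x K) := rfl

theorem Phi.add_app (x y : Phi M) (H : Subgroup G) : (x + y) H = x H + y H := rfl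

theorem Phi.zero_app (H : Subgroup G) : (0 : Phi M) H = 0 := rfl

theorem Phi.rsmul_app (r : R) (x : Phi M) (H : Subgroup G) : (r • x) H = r • x H := rfl

instance : Module (MackeyAlgebra R G) (Phi M) where
  one_smul x := by
    refine funext fun H => ?_
    rw [Phi.smul_app, Finset.sum_eq_single H, MackeyAlgebra.one_app_same, M.ap_id]
    · intro K _ hK
      rw [MackeyAlgebra.one_app_ne (Ne.symm hK), M.ap_zero]
    · simp
  mul_smul a b x := by
    refine funext fun H => ?_
    simp only [Phi.smul_app, MackeyAlgebra.mul_app, M.ap_sum, M.ap_comp, map_sum]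
    exact Finset.sum_comm
  smul_zero a := by
    refine funext fun H => ?_
    simp [Phi.smul_app, Phi.zero_app]
  smul_add a x y := by
    refine funext fun H => ?_
    simp [Phi.smul_app, Phi.add_app, Finset.sum_add_distrib]
  add_smul a b x := by
    refine funext fun H => ?_
    simp [Phi.smul_app, Phi.add_app, M.ap_add, Finset.sum_add_distrib]
  zero_smul x := by
    refine funext fun H => ?_
    simp [Phi.smul_app, Phi.zero_app, M.ap_zero]

instance : IsScalarTower R (MackeyAlgebra R G) (Phi M) where
  smul_assoc r a x := by
    refine funext fun H => ?_
    simp [Phi.smul_app, Phi.rsmul_app, M.ap_smul, Finset.smul_sum]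

variable {M N} in
/-- `Φ` on morphisms. -/
def Phi.map (φ : M.Hom N) : Phi M →ₗ[MackeyAlgebra R G] Phi N where
  toFun x H := φ.at (orb R H) (x H)
  map_add' x y := by
    refine funext fun H => ?_
    exact LinearMap.map_add _ _ _
  map_smul' a x := by
    refine funext fun H => ?_
    change φ.at (orb R H) (∑ K, M.ap (a H K) (x K)) = ∑ K, N.ap (a H K) (φ.at (orb R K) (x K))
    simp [MackeyFunctor.Hom.at_ap]

open Classical in
/-- The inclusion of `M(G/H)` in `Φ M`. -/
def Phi.inc (H : Subgroup G) : M.val (orb R H) →ₗ[R] Phi M :=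
  LinearMap.single R (fun H : Subgroup G => M.val (orb R H)) H

theorem Phi.inc_same (H : Subgroup G) (m : M.val (orb R H)) : Phi.inc M H m H = m := by
  classical
  exact Pi.single_eq_same (M := fun H : Subgroup G => M.val (orb R H)) H m

theorem Phi.inc_ne {H K : Subgroup G} (h : K ≠ H) (m : M.val (orb R H)) :
    Phi.inc M H m K = 0 := by
  classical
  exact Pi.single_eq_of_ne (M := fun H : Subgroup G => M.val (orb R H)) h m

theorem Phi.single_smul {H K : Subgroup G} (f : orb R H ⟶ orb R K) (x : Phi M) :
    MackeyAlgebra.single H K f • x = Phi.inc M H (M.ap f (x K)) := by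
  refine funext fun J => ?_
  rw [Phi.smul_app, Finset.sum_eq_single K]
  · by_cases hJ : J = H
    · subst hJ
      rw [MackeyAlgebra.single_same, Phi.inc_same]
    · rw [MackeyAlgebra.single_of_ne_left _ hJ, M.ap_zero, Phi.inc_ne M hJ]
  · intro L _ hL
    rw [MackeyAlgebra.single_of_ne_right _ hL, M.ap_zero]
  · simp

/-- The identification `M(G/H) = I^H_H Φ M`. -/
def Phi.gr (H : Subgroup G) : M.val (orb R H) ≃ₗ[R] grade R (Phi M) H :=
  LinearEquiv.ofLinearMap
    ((Phi.inc M H).codRestrict _ fun m => mem_grade.2 (by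
      rw [MackeyAlgebra.indEl_self, Phi.single_smul, M.ap_id, Phi.inc_same]))
    (LinearMap.proj (φ := fun H : Subgroup G => M.val (orb R H)) H ∘ₗ
      (grade R (Phi M) H).subtype)
    (LinearMap.ext fun x => Subtype.ext (by
      have h := mem_grade.1 x.2
      rw [MackeyAlgebra.indEl_self, Phi.single_smul, M.ap_id] at h
      exact h))
    (LinearMap.ext fun m => Phi.inc_same M H m)

theorem Phi.coe_gr (H : Subgroup G) (m : M.val (orb R H)) :
    (Phi.gr M H m : Phi M) = Phi.inc M H m := rfl

/-- The class in `Φ M □ Φ N` of the element `m ⊗ n` of the first summand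
`M(G/H) ⊗ N(G/H)` of the grade `H`. -/
def firstTensor (H : Subgroup G) (m : M.val (orb R H)) (n : N.val (orb R H)) :
    Box (G := G) R (Phi M) (Phi N) :=
  Box.mk R (Phi M) (Phi N) (BoxSum.inc R (Phi M) (Phi N) H
    (BoxGrade.first R (Phi M) (Phi N) H (Phi.gr M H m ⊗ₜ[R] Phi.gr N H n)))

end Phi

end MackeyBox

end

open MackeyBox

/-!
Every finite `G`-set is the disjoint union of its orbits, and every map of transitive `G`-sets is a
conjugation followed by a projection. Hence a Dress pairing amounts to maps
`M(G/H) ⊗ N(G/H) → P(G/H)` which are compatible with `C_{g,H}` and `R^H_K` and satisfy Frobenius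
reciprocity for `I^H_K`. As `A` is generated from its first summands by transfers, such a family
extends uniquely along transfers to `A`. The extension commutes with `R^H_J` by the Mackey double
coset formula, kills `FR` by Frobenius reciprocity, and kills `Rel` because `Φ P` is a
`μ_R(G)`-module.
-/

noncomputable section

namespace MackeyBox

variable {R : Type w} [CommRing R] {G : Type u} [Group G]

/-! ### Spans -/

theorem GSpan.equivalent_of_bijective {X Y : FinGSet G} {S T : GSpan X Y}
    (φ : S.apex →[G] T.apex) (hφ : Function.Bijective φ) (hl : ∀ v, T.left (φ v) = S.left v)
    (hr : ∀ v, T.right (φ v) = S.right v) : S.Equivalent T :=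
  ⟨Equiv.ofBijective φ hφ, map_smul φ, hl, hr⟩

/-- The span `X ← V → Y` obtained from `X ← S → Y` by precomposing both legs with `j : V → S`. -/
def GSpan.along {X Y V : FinGSet G} (S : GSpan X Y) (j : V →[G] S.apex) : GSpan X Y :=
  ⟨V, S.left.comp j, S.right.comp j⟩

/-- The map `V → {(x, y) | f x = g y}` with components `a` and `b`. -/
def FinGSet.pullbackLift {V X Y Z : FinGSet G} {f : X →[G] Z} {g : Y →[G] Z} (a : V →[G] X)
    (b : V →[G] Y) (h : ∀ v, f (a v) = g (b v)) : V →[G] FinGSet.pullback f g where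
  toFun v := (⟨(a v, b v), h v⟩ : {p : X × Y // f p.1 = g p.2})
  map_smul' k v := Subtype.ext (Prod.ext (map_smul a k v) (map_smul b k v))

namespace Omega

theorem id_eq_span (X : Omega R G) :
    𝟙 X = span ⟨X.gset, MulActionHom.id G, MulActionHom.id G⟩ := rfl

theorem span_eq_zero {X Y : Omega R G} (S : GSpan X.gset Y.gset) [hS : IsEmpty S.apex] :
    (span S : X ⟶ Y) = 0 := by
  refine (span_eq (GSpan.equivalent_of_bijective (S := GSpan.zero X.gset Y.gset)
    ⟨fun v => PEmpty.elim v, fun _ v => PEmpty.elim v⟩ ⟨fun v => PEmpty.elim v, hS.elim⟩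
    (fun v => PEmpty.elim v) fun v => PEmpty.elim v)).symm.trans (span_zero X Y)

theorem res_comp_res {X Y Z : Omega R G} (f : X.gset →[G] Y.gset) (g : Y.gset →[G] Z.gset) :
    (res f : X ⟶ Y) ≫ res g = res (g.comp f) := by
  unfold res
  rw [span_comp]
  exact span_eq ⟨⟨fun p => p.1.1, fun x => ⟨(x, f x), rfl⟩,
    fun p => Subtype.ext (Prod.ext rfl p.2), fun _ => rfl⟩, fun _ _ => rfl,
    fun _ => rfl, fun p => congrArg g p.2⟩

theorem res_comp_tr_of_disjoint {X Y Z : Omega R G} (f : X.gset →[G] Z.gset)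
    (g : Y.gset →[G] Z.gset) (h : ∀ x y, f x ≠ g y) : (res f : X ⟶ Z) ≫ tr g = 0 := by
  unfold res tr
  rw [span_comp]
  exact span_eq_zero _ (hS := ⟨fun p => h _ _ p.2⟩)

theorem res_comp_tr_self {X Y : Omega R G} (f : X.gset →[G] Y.gset)
    (hf : Function.Injective f) : (res f : X ⟶ Y) ≫ tr f = 𝟙 X := by
  unfold res tr
  rw [span_comp, id_eq_span]
  exact span_eq ⟨⟨fun p => p.1.1, fun x => ⟨(x, x), rfl⟩,
    fun p => Subtype.ext (Prod.ext rfl (hf p.2)), fun _ => rfl⟩, fun _ _ => rfl,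
    fun _ => rfl, fun p => hf p.2⟩

theorem tr_comp_res_self {X Y : Omega R G} (f : X.gset →[G] Y.gset)
    (hf : Function.Bijective f) : (tr f : Y ⟶ X) ≫ res f = 𝟙 Y := by
  rw [tr_comp_res, id_eq_span]
  exact span_eq (GSpan.equivalent_of_bijective (T := ⟨Y.gset, _, _⟩) f hf
    (fun _ => rfl) fun _ => rfl)

theorem span_restrict_of_forall {X Y : Omega R G} (S : GSpan X.gset Y.gset) {p : S.apex → Prop}
    (hp : ∀ (g : G) v, p v → p (g • v)) (h : ∀ v, p v) :
    (span (S.restrict p hp) : X ⟶ Y) = span S :=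
  span_eq ⟨Equiv.subtypeUnivEquiv h, fun _ _ => rfl, fun _ => rfl, fun _ => rfl⟩

theorem span_restrict_eq_along_add {X Y : Omega R G} (S : GSpan X.gset Y.gset) {V : FinGSet G}
    (j : V →[G] S.apex) (hj : Function.Injective j) {p q : S.apex → Prop}
    (hp : ∀ (g : G) v, p v → p (g • v)) (hq : ∀ (g : G) v, q v → q (g • v))
    (hjp : ∀ x, ¬ p (j x)) (hpq : ∀ v, q v ↔ (∃ x, j x = v) ∨ p v) :
    (span (S.restrict q hq) : X ⟶ Y) = span (S.along j) + span (S.restrict p hp) := by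
  let φ : (V : Type u) ⊕ {v : S.apex // p v} → {v : S.apex // q v} :=
    Sum.elim (fun x => ⟨j x, (hpq _).2 (.inl ⟨x, rfl⟩)⟩) fun v => ⟨v, (hpq _).2 (.inr v.2)⟩
  have φ_injective : Function.Injective φ := by
    rintro (x | v) (x' | v') h <;> have h := congrArg Subtype.val h
    · exact congrArg Sum.inl (hj h)
    · exact (hjp x ((congrArg p h).mpr v'.2)).elim
    · exact (hjp x' ((congrArg p h).mp v.2)).elim
    · exact congrArg Sum.inr (Subtype.ext h)
  have φ_surjective : Function.Surjective φ := by
    rintro ⟨v, hv⟩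
    rcases (hpq v).1 hv with ⟨x, rfl⟩ | hv
    · exact ⟨.inl x, rfl⟩
    · exact ⟨.inr ⟨v, hv⟩, rfl⟩
  rw [← span_add]
  refine (span_eq ⟨Equiv.ofBijective φ ⟨φ_injective, φ_surjective⟩, ?_, ?_, ?_⟩).symm
  · rintro g (x | v)
    · exact Subtype.ext (map_smul j g x)
    · rfl
  all_goals rintro (x | v) <;> rfl

theorem span_eq_sum_along {X Y : Omega R G} (S : GSpan X.gset Y.gset) {ι : Type*} [Fintype ι]
    {V : ι → FinGSet G} (j : ∀ i, V i →[G] S.apex) (hinj : ∀ i, Function.Injective (j i))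
    (hdisj : ∀ i i' x x', j i x = j i' x' → i = i') (hsurj : ∀ v, ∃ i x, j i x = v) :
    (span S : X ⟶ Y) = ∑ i, span (S.along (j i)) := by
  classical
  have hstable (s : Finset ι) (g : G) (v) :
      (∃ i ∈ s, ∃ x, j i x = v) → ∃ i ∈ s, ∃ x, j i x = g • v := by
    rintro ⟨i, hi, x, rfl⟩
    exact ⟨i, hi, g • x, map_smul _ _ _⟩
  have span_restrict (s : Finset ι) : (span (S.restrict _ (hstable s)) : X ⟶ Y) =
      ∑ i ∈ s, span (S.along (j i)) := by
    induction s using Finset.induction_on with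
    | empty =>
      rw [Finset.sum_empty]
      exact span_eq_zero _ (hS := ⟨fun ⟨_, i, hi, _⟩ => Finset.notMem_empty i hi⟩)
    | insert i s hi ih =>
      rw [Finset.sum_insert hi, ← ih]
      refine span_restrict_eq_along_add S (j i) (hinj i) _ _ ?_ fun v => Finset.exists_mem_insert ..
      rintro x ⟨i', hi', x', h⟩
      exact hi (hdisj i' i x' x h ▸ hi')
  rw [← span_restrict, span_restrict_of_forall]
  intro v
  obtain ⟨i, x, h⟩ := hsurj v
  exact ⟨i, Finset.mem_univ i, x, h⟩

end Omega

/-! ### Double cosets -/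

namespace DCos

variable {J H K : Subgroup G}

theorem rep_mem (q : DCos J H K) : q.rep ∈ H :=
  (Quotient.out q : H).2

theorem eq_of_rep_eq_mul {q q' : DCos J H K} {a b : G} (hJ : J ≤ H) (hK : K ≤ H) (ha : a ∈ J)
    (hb : b ∈ K) (h : q'.rep = a * q.rep * b) : q = q' := by
  rw [← Quotient.out_eq q, ← Quotient.out_eq q']
  exact Quotient.sound (DoubleCoset.rel_iff.2 ⟨⟨a, hJ ha⟩, ha, ⟨b, hK hb⟩, hb, Subtype.ext h⟩)

theorem exists_rep_eq_mul {h : G} (hh : h ∈ H) :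
    ∃ q : DCos J H K, ∃ a ∈ J, ∃ b ∈ K, q.rep = a * h * b := by
  let q : DCos J H K := Quotient.mk _ ⟨h, hh⟩
  have hq : (DoubleCoset.setoid (J.subgroupOf H : Set H) (K.subgroupOf H : Set H)) ⟨h, hh⟩
      (Quotient.out q) := Quotient.exact (Quotient.out_eq q).symm
  obtain ⟨a, ha, b, hb, e⟩ := DoubleCoset.rel_iff.1 hq
  exact ⟨q, a, ha, b, hb, congrArg Subtype.val e⟩

end DCos

/-! ### Transitive `G`-sets and their maps -/

section Orbit

variable [Finite G]

/-- The coset `kH` as a point of the `G`-set `G/H`. -/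
def orbitMk (H : Subgroup G) (k : G) : orbit H := (k : G ⧸ H)

theorem orbitMk_surjective (H : Subgroup G) : Function.Surjective (orbitMk H) :=
  QuotientGroup.mk_surjective

theorem orbitMk_eq {H : Subgroup G} {a b : G} : orbitMk H a = orbitMk H b ↔ a⁻¹ * b ∈ H :=
  QuotientGroup.eq

theorem smul_orbitMk (H : Subgroup G) (g k : G) : g • orbitMk H k = orbitMk H (g * k) := rfl

theorem proj_orbitMk {K H : Subgroup G} (h : K ≤ H) (k : G) :
    proj h (orbitMk K k) = orbitMk H k := rfl

theorem cmap_orbitMk (g : G) (H : Subgroup G) (k : G) :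
    cmap g H (orbitMk H k) = orbitMk (conj g H) (k * g⁻¹) := rfl

theorem orbitHom_ext {X : FinGSet G} {H : Subgroup G} {f f' : orbit H →[G] X}
    (h : ∀ k, f (orbitMk H k) = f' (orbitMk H k)) : f = f' :=
  MulActionHom.ext ((orbitMk_surjective H).forall.2 h)

theorem cmap_bijective (g : G) (H : Subgroup G) : Function.Bijective (cmap g H) := by
  constructor
  · intro x y h
    obtain ⟨a, rfl⟩ := orbitMk_surjective H x
    obtain ⟨b, rfl⟩ := orbitMk_surjective H y
    rw [cmap_orbitMk, cmap_orbitMk, orbitMk_eq, mem_conj] at h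
    exact orbitMk_eq.2 (by simpa [mul_assoc] using h)
  · intro y
    obtain ⟨b, rfl⟩ := orbitMk_surjective _ y
    exact ⟨orbitMk H (b * g), by rw [cmap_orbitMk, mul_inv_cancel_right]⟩

theorem cmap_comp_proj (g : G) {K H : Subgroup G} (h : K ≤ H) :
    (cmap g H).comp (proj h) = (proj (conj_mono g h)).comp (cmap g K) :=
  orbitHom_ext fun _ => rfl

theorem proj_refl (H : Subgroup G) : proj (le_refl H) = MulActionHom.id G :=
  orbitHom_ext fun _ => rfl

theorem exists_eq_proj_comp_cmap {K H : Subgroup G} (f : orbit K →[G] orbit H) :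
    ∃ (g : G) (h : conj g K ≤ H), f = (proj h).comp (cmap g K) := by
  obtain ⟨a, ha⟩ := orbitMk_surjective H (f (orbitMk K 1))
  have hf (k : G) : f (orbitMk K k) = orbitMk H (k * a) := by
    rw [← smul_orbitMk, ha, ← map_smul, smul_orbitMk, mul_one]
  have hH : conj a⁻¹ K ≤ H := by
    intro z hz
    have hz : orbitMk K 1 = orbitMk K (a * z * a⁻¹) :=
      orbitMk_eq.2 (by simpa using mem_conj.1 hz)
    have hz := congrArg f hz
    rw [hf, hf, orbitMk_eq] at hz
    simpa [mul_assoc] using hz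
  refine ⟨a⁻¹, hH, orbitHom_ext fun k => ?_⟩
  rw [hf, MulActionHom.comp_apply, cmap_orbitMk, proj_orbitMk, inv_inv]

/-- The map `G/(K ∩ Jᵍ) → {(x, y) ∈ G/J × G/K | x H = y H}` with `1 ↦ (g⁻¹ J, K)`, where `g` is
the representative of the double coset `q`: its image is the orbit labelled by `q`. -/
def doubleCosetMap {J H K : Subgroup G} (hJ : J ≤ H) (hK : K ≤ H) (q : DCos J H K) :
    orbit (K ⊓ conj q.rep⁻¹ J) →[G] FinGSet.pullback (proj hJ) (proj hK) :=
  FinGSet.pullbackLift ((proj (conj_inf_le q.rep K J)).comp (cmap q.rep _)) (proj inf_le_left)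
    ((orbitMk_surjective _).forall.2 fun _ => orbitMk_eq.2 (by simpa using q.rep_mem))

section DoubleCoset

variable {J H K : Subgroup G} (hJ : J ≤ H) (hK : K ≤ H)

theorem doubleCosetMap_eq_iff {q q' : DCos J H K} {a b : G} :
    doubleCosetMap hJ hK q (orbitMk _ a) = doubleCosetMap hJ hK q' (orbitMk _ b) ↔
      (a * q.rep⁻¹)⁻¹ * (b * q'.rep⁻¹) ∈ J ∧ a⁻¹ * b ∈ K :=
  Subtype.ext_iff.trans (Prod.ext_iff.trans (and_congr orbitMk_eq orbitMk_eq))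

theorem doubleCosetMap_injective (q : DCos J H K) :
    Function.Injective (doubleCosetMap hJ hK q) := by
  intro x y h
  obtain ⟨a, rfl⟩ := orbitMk_surjective _ x
  obtain ⟨b, rfl⟩ := orbitMk_surjective _ y
  obtain ⟨hJ', hK'⟩ := (doubleCosetMap_eq_iff hJ hK).1 h
  refine orbitMk_eq.2 (Subgroup.mem_inf.2 ⟨hK', mem_conj.2 ?_⟩)
  simpa [mul_assoc] using hJ'

theorem eq_of_doubleCosetMap_eq {q q' : DCos J H K} {x : orbit (K ⊓ conj q.rep⁻¹ J)}
    {y : orbit (K ⊓ conj q'.rep⁻¹ J)}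
    (h : doubleCosetMap hJ hK q x = doubleCosetMap hJ hK q' y) : q = q' := by
  obtain ⟨a, rfl⟩ := orbitMk_surjective _ x
  obtain ⟨b, rfl⟩ := orbitMk_surjective _ y
  obtain ⟨hJ', hK'⟩ := (doubleCosetMap_eq_iff hJ hK).1 h
  exact DCos.eq_of_rep_eq_mul hJ hK (J.inv_mem hJ') hK' (by group)

theorem exists_doubleCosetMap_eq (v : FinGSet.pullback (proj hJ) (proj hK)) :
    ∃ (q : DCos J H K) (x : _), doubleCosetMap hJ hK q x = v := by
  obtain ⟨⟨x, y⟩, h⟩ := v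
  obtain ⟨a, rfl⟩ := orbitMk_surjective J x
  obtain ⟨b, rfl⟩ := orbitMk_surjective K y
  obtain ⟨q, c, hc, d, hd, hq⟩ := DCos.exists_rep_eq_mul (J := J) (K := K) (orbitMk_eq.1 h)
  refine ⟨q, orbitMk _ (b * d), Subtype.ext (Prod.ext (orbitMk_eq.2 ?_) (orbitMk_eq.2 ?_))⟩
  · simpa [hq, mul_assoc] using hc
  · simpa using hd

theorem Omega.res_proj_comp_tr_proj :
    res (X := orb R J) (Y := orb R H) (proj hJ) ≫ tr (X := orb R K) (Y := orb R H) (proj hK) =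
    ∑ q : DCos J H K, tr (X := orb R _) (Y := orb R J) (proj (conj_inf_le q.rep K J)) ≫
      tr (X := orb R (K ⊓ conj q.rep⁻¹ J)) (Y := orb R _) (cmap q.rep _) ≫
      res (X := orb R (K ⊓ conj q.rep⁻¹ J)) (Y := orb R K) (proj inf_le_left) := by
  rw [res, tr, span_comp, span_eq_sum_along (X := orb R J) (Y := orb R K) _
    (doubleCosetMap hJ hK) (doubleCosetMap_injective hJ hK)
    (fun _ _ _ _ => eq_of_doubleCosetMap_eq hJ hK) (exists_doubleCosetMap_eq hJ hK)]
  refine Finset.sum_congr rfl fun q _ => ?_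
  rw [← Category.assoc, tr_comp_tr, tr_comp_res]
  rfl

end DoubleCoset

end Orbit

/-! ### The decomposition of a `G`-set into orbits -/

/-- The set of orbits of a finite `G`-set. -/
abbrev Orbits (X : FinGSet G) : Type u := MulAction.orbitRel.Quotient G X

namespace Orbits

variable {X : FinGSet G}

instance : Fintype (Orbits X) :=
  haveI : Finite (Orbits X) := Quotient.finite _
  Fintype.ofFinite _

/-- The orbit of a point. -/
def of (x : X) : Orbits X := Quotient.mk _ x

/-- The stabilizer of the chosen representative of an orbit. -/
def stab (ω : Orbits X) : Subgroup G := MulAction.stabilizer G (Quotient.out ω : X)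

variable [Finite G]

/-- The isomorphism of `G/H` with an orbit `ω ⊆ X`, as a map to `X`, where `H` is the stabilizer of
the chosen representative of `ω`. -/
def inj (ω : Orbits X) : orbit ω.stab →[G] X where
  toFun := MulAction.ofQuotientStabilizer G (Quotient.out ω)
  map_smul' g v := by
    obtain ⟨k, rfl⟩ := orbitMk_surjective _ v
    exact mul_smul g k _

theorem inj_injective (ω : Orbits X) : Function.Injective ω.inj :=
  MulAction.injective_ofQuotientStabilizer G (Quotient.out ω)

theorem of_inj (ω : Orbits X) (v : orbit ω.stab) : of (ω.inj v) = ω := by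
  obtain ⟨k, rfl⟩ := orbitMk_surjective _ v
  exact (Quotient.sound ⟨k, rfl⟩ : of (k • Quotient.out ω) = of (Quotient.out ω)).trans
    (Quotient.out_eq ω)

theorem eq_of_inj_eq {ω ω' : Orbits X} {v : orbit ω.stab} {v' : orbit ω'.stab}
    (h : ω.inj v = ω'.inj v') : ω = ω' := by
  rw [← ω.of_inj v, h, ω'.of_inj]

theorem exists_inj_eq (x : X) : ∃ v, (of x).inj v = x := by
  obtain ⟨k, hk⟩ : (MulAction.orbitRel G X) x (Quotient.out (of x)) :=
    Quotient.exact (Quotient.out_eq (of x)).symm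
  exact ⟨orbitMk _ k, hk⟩

theorem exists_eq_inj_comp {K : Subgroup G} (f : orbit K →[G] X) :
    ∃ (ω : Orbits X) (f' : orbit K →[G] orbit ω.stab), f = ω.inj.comp f' := by
  let ω := of (f (orbitMk K 1))
  obtain ⟨w, hw⟩ : ∃ w, ω.inj w = f (orbitMk K 1) := exists_inj_eq _
  have hf (v : orbit K) : ∃ w, ω.inj w = f v := by
    obtain ⟨k, rfl⟩ := orbitMk_surjective _ v
    exact ⟨k • w, by rw [map_smul, hw, ← map_smul, smul_orbitMk, mul_one]⟩
  choose f' hf' using hf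
  refine ⟨ω, ⟨f', fun g v => ω.inj_injective ?_⟩, MulActionHom.ext fun v => (hf' v).symm⟩
  rw [map_smul, hf', hf']
  exact map_smul f g v

end Orbits

section Decomposition

variable [Finite G]

theorem Omega.id_eq_sum_tr_comp_res (X : Omega R G) : 𝟙 X = ∑ ω : Orbits X.gset,
    tr (X := orb R ω.stab) ω.inj ≫ res (X := orb R ω.stab) ω.inj := by
  refine (span_eq_sum_along (X := X) (Y := X) ⟨X.gset, MulActionHom.id G, MulActionHom.id G⟩
    Orbits.inj Orbits.inj_injective (fun _ _ _ _ => Orbits.eq_of_inj_eq)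
    fun x => ⟨Orbits.of x, Orbits.exists_inj_eq x⟩).trans ?_
  exact Finset.sum_congr rfl fun ω _ => (tr_comp_res _ _).symm

theorem Orbits.res_comp_tr_of_ne {X : Omega R G} {ω ω' : Orbits X.gset} (h : ω ≠ ω') :
    Omega.res (X := orb R ω.stab) (Y := X) ω.inj ≫ Omega.tr (X := orb R ω'.stab) ω'.inj = 0 :=
  Omega.res_comp_tr_of_disjoint _ _ fun _ _ e => h (eq_of_inj_eq e)

end Decomposition

/-! ### Restrictions and transfers of Mackey functors -/

namespace MackeyFunctor

variable (M : MackeyFunctor.{u, v, w} R G)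

/-- The restriction `r_f`, as a function of a map `f` of finite `G`-sets instead of a map between
the `G`-sets of two objects of `Ω_R(G)`, so that these objects can be inferred from `f`. -/
abbrev rMap {X Y : FinGSet G} (f : X →[G] Y) : M.val ⟨Y⟩ →ₗ[R] M.val ⟨X⟩ :=
  M.r (X := ⟨X⟩) (Y := ⟨Y⟩) f

/-- The transfer `t_f`, with the same convention as in `MackeyFunctor.rMap`. -/
abbrev tMap {X Y : FinGSet G} (f : X →[G] Y) : M.val ⟨X⟩ →ₗ[R] M.val ⟨Y⟩ :=
  M.t (X := ⟨X⟩) (Y := ⟨Y⟩) f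

theorem rMap_rMap {X Y Z : FinGSet G} (f : X →[G] Y) (g : Y →[G] Z) (x : M.val ⟨Z⟩) :
    M.rMap f (M.rMap g x) = M.rMap (g.comp f) x := by
  rw [rMap, rMap, r, r, ← ap_comp, Omega.res_comp_res, rMap, r]

theorem tMap_tMap {X Y Z : FinGSet G} (f : X →[G] Y) (g : Y →[G] Z) (x : M.val ⟨X⟩) :
    M.tMap g (M.tMap f x) = M.tMap (g.comp f) x := by
  rw [tMap, tMap, t, t, ← ap_comp, Omega.tr_comp_tr, tMap, t]

theorem rMap_tMap_self {X Y : FinGSet G} {f : X →[G] Y} (hf : Function.Injective f)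
    (x : M.val ⟨X⟩) : M.rMap f (M.tMap f x) = x := by
  rw [rMap, tMap, r, t, ← ap_comp, Omega.res_comp_tr_self f hf, ap_id]

theorem tMap_rMap_self {X Y : FinGSet G} {f : X →[G] Y} (hf : Function.Bijective f)
    (x : M.val ⟨Y⟩) : M.tMap f (M.rMap f x) = x := by
  rw [rMap, tMap, r, t, ← ap_comp, Omega.tr_comp_res_self f hf, ap_id]

theorem rMap_id {X : FinGSet G} (x : M.val ⟨X⟩) :
    M.rMap (MulActionHom.id G : X →[G] X) x = x :=
  M.ap_id ⟨X⟩ x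

variable [Finite G]

theorem sum_tMap_inj_rMap_inj {X : FinGSet G} (x : M.val ⟨X⟩) :
    ∑ ω : Orbits X, M.tMap ω.inj (M.rMap ω.inj x) = x := by
  conv_rhs => rw [← M.ap_id ⟨X⟩ x, Omega.id_eq_sum_tr_comp_res, ap_sum]
  exact Finset.sum_congr rfl fun ω _ => (M.ap_comp _ _ x).symm

theorem rMap_inj_tMap_inj_of_ne {X : FinGSet G} {ω ω' : Orbits X} (h : ω ≠ ω')
    (x : M.val (orb R ω'.stab)) : M.rMap ω.inj (M.tMap ω'.inj x) = 0 := by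
  rw [rMap, tMap, r, t, ← ap_comp, Orbits.res_comp_tr_of_ne (X := ⟨X⟩) h, ap_zero]

theorem ext_rMap {X : FinGSet G} {x y : M.val ⟨X⟩}
    (h : ∀ (K : Subgroup G) (f : orbit K →[G] X), M.rMap f x = M.rMap f y) : x = y := by
  rw [← M.sum_tMap_inj_rMap_inj x, ← M.sum_tMap_inj_rMap_inj y]
  exact Finset.sum_congr rfl fun ω _ => by rw [h]

end MackeyFunctor

/-! ### Dress pairings on transitive `G`-sets -/

section OrbitPairing

variable [Finite G]

/-- A Dress pairing that is only defined on the transitive `G`-sets `G/H`. -/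
@[ext] structure OrbitPairing (M N P : MackeyFunctor.{u, v, w} R G) where
  /-- the maps `M(G/H) ⊗ N(G/H) → P(G/H)` -/
  θ : ∀ H : Subgroup G, M.val (orb R H) ⊗[R] N.val (orb R H) →ₗ[R] P.val (orb R H)
  res : ∀ {K H : Subgroup G} (f : orbit K →[G] orbit H) (m : M.val (orb R H))
    (n : N.val (orb R H)), P.rMap f (θ H (m ⊗ₜ n)) = θ K (M.rMap f m ⊗ₜ N.rMap f n)
  frob_left : ∀ {K H : Subgroup G} (f : orbit K →[G] orbit H) (m : M.val (orb R K))
    (n : N.val (orb R H)), P.tMap f (θ K (m ⊗ₜ N.rMap f n)) = θ H (M.tMap f m ⊗ₜ n)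
  frob_right : ∀ {K H : Subgroup G} (f : orbit K →[G] orbit H) (m : M.val (orb R H))
    (n : N.val (orb R K)), P.tMap f (θ K (M.rMap f m ⊗ₜ n)) = θ H (m ⊗ₜ N.tMap f n)

namespace OrbitPairing

variable {M N P : MackeyFunctor.{u, v, w} R G}

/-- The same pairing with its two arguments exchanged. -/
def swap (θ : OrbitPairing M N P) : OrbitPairing N M P where
  θ H := θ.θ H ∘ₗ (TensorProduct.comm R _ _).toLinearMap
  res f n m := θ.res f m n
  frob_left f n m := θ.frob_right f m n
  frob_right f n m := θ.frob_left f m n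

variable (θ : OrbitPairing M N P)

theorem tMap_tmul {K H : Subgroup G} {f : orbit K →[G] orbit H} (hf : Function.Injective f)
    (m : M.val (orb R K)) (n : N.val (orb R K)) :
    P.tMap f (θ.θ K (m ⊗ₜ n)) = θ.θ H (M.tMap f m ⊗ₜ N.tMap f n) := by
  rw [← θ.frob_left, N.rMap_tMap_self hf]

/-- The extension of a pairing from transitive to arbitrary finite `G`-sets, orbit by orbit. -/
def extend (X : FinGSet G) : M.val ⟨X⟩ ⊗[R] N.val ⟨X⟩ →ₗ[R] P.val ⟨X⟩ :=
  ∑ ω : Orbits X,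
    P.tMap ω.inj ∘ₗ θ.θ ω.stab ∘ₗ TensorProduct.map (M.rMap ω.inj) (N.rMap ω.inj)

theorem extend_tmul {X : FinGSet G} (m : M.val ⟨X⟩) (n : N.val ⟨X⟩) :
    θ.extend X (m ⊗ₜ n) =
      ∑ ω : Orbits X, P.tMap ω.inj (θ.θ ω.stab (M.rMap ω.inj m ⊗ₜ N.rMap ω.inj n)) := by
  simp only [extend, LinearMap.sum_apply, LinearMap.comp_apply, TensorProduct.map_tmul]

theorem rMap_inj_extend {X : FinGSet G} (ω : Orbits X) (m : M.val ⟨X⟩) (n : N.val ⟨X⟩) :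
    P.rMap ω.inj (θ.extend X (m ⊗ₜ n)) =
      θ.θ ω.stab (M.rMap ω.inj m ⊗ₜ N.rMap ω.inj n) := by
  rw [extend_tmul, map_sum, Finset.sum_eq_single ω]
  · exact P.rMap_tMap_self ω.inj_injective _
  · exact fun ω' _ hω => P.rMap_inj_tMap_inj_of_ne hω.symm _
  · exact fun h => (h (Finset.mem_univ ω)).elim

theorem rMap_extend {X : FinGSet G} {K : Subgroup G} (f : orbit K →[G] X) (m : M.val ⟨X⟩)
    (n : N.val ⟨X⟩) :
    P.rMap f (θ.extend X (m ⊗ₜ n)) = θ.θ K (M.rMap f m ⊗ₜ N.rMap f n) := by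
  obtain ⟨ω, f', rfl⟩ := Orbits.exists_eq_inj_comp f
  rw [← P.rMap_rMap, rMap_inj_extend, θ.res, M.rMap_rMap, N.rMap_rMap]

theorem extend_tMap_inj_tmul {X : FinGSet G} (ω : Orbits X) (m : M.val (orb R ω.stab))
    (n : N.val ⟨X⟩) :
    θ.extend X (M.tMap ω.inj m ⊗ₜ n) = P.tMap ω.inj (θ.θ ω.stab (m ⊗ₜ N.rMap ω.inj n)) := by
  rw [extend_tmul, Finset.sum_eq_single ω]
  · rw [M.rMap_tMap_self ω.inj_injective]
  · intro ω' _ hω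
    rw [M.rMap_inj_tMap_inj_of_ne hω, TensorProduct.zero_tmul, map_zero, map_zero]
  · exact fun h => (h (Finset.mem_univ ω)).elim

theorem extend_tMap_tmul {X : FinGSet G} {K : Subgroup G} (f : orbit K →[G] X)
    (m : M.val (orb R K)) (n : N.val ⟨X⟩) :
    θ.extend X (M.tMap f m ⊗ₜ n) = P.tMap f (θ.θ K (m ⊗ₜ N.rMap f n)) := by
  obtain ⟨ω, f', rfl⟩ := Orbits.exists_eq_inj_comp f
  rw [← M.tMap_tMap, extend_tMap_inj_tmul, ← θ.frob_left, P.tMap_tMap, N.rMap_rMap]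

theorem extend_frob_left {X Y : FinGSet G} (f : X →[G] Y) (m : M.val ⟨X⟩) (n : N.val ⟨Y⟩) :
    P.tMap f (θ.extend X (m ⊗ₜ N.rMap f n)) = θ.extend Y (M.tMap f m ⊗ₜ n) := by
  rw [← M.sum_tMap_inj_rMap_inj m]
  simp only [TensorProduct.sum_tmul, map_sum, extend_tMap_tmul, MackeyFunctor.tMap_tMap,
    MackeyFunctor.rMap_rMap]

theorem extend_swap {X : FinGSet G} (m : M.val ⟨X⟩) (n : N.val ⟨X⟩) :
    θ.swap.extend X (n ⊗ₜ m) = θ.extend X (m ⊗ₜ n) := by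
  rw [extend_tmul, extend_tmul]
  rfl

theorem extend_frob_right {X Y : FinGSet G} (f : X →[G] Y) (m : M.val ⟨Y⟩) (n : N.val ⟨X⟩) :
    P.tMap f (θ.extend X (M.rMap f m ⊗ₜ n)) = θ.extend Y (m ⊗ₜ N.tMap f n) := by
  rw [← θ.extend_swap (M.rMap f m), ← θ.extend_swap m, extend_frob_left]

/-- The Dress pairing given by the extension of a pairing to all finite `G`-sets. -/
def toDressPairing : DressPairing M N P where
  θ X := θ.extend X.gset
  res {X Y} f m n := P.ext_rMap fun K k => by
    rw [rMap_extend, P.rMap_rMap, rMap_extend, M.rMap_rMap, N.rMap_rMap]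
  frob_left f m n := θ.extend_frob_left f m n
  frob_right f m n := θ.extend_frob_right f m n

theorem extend_orbit (H : Subgroup G) : θ.extend (orbit H) = θ.θ H := by
  refine TensorProduct.ext' fun m n => ?_
  have h := θ.rMap_extend (MulActionHom.id G : orbit H →[G] orbit H) m n
  rwa [P.rMap_id, M.rMap_id, N.rMap_id] at h

/-- The restriction of a Dress pairing to the transitive `G`-sets `G/H`. -/
def ofDressPairing (θ : DressPairing M N P) : OrbitPairing M N P where
  θ H := θ.θ (orb R H)
  res f := θ.res f
  frob_left f := θ.frob_left f
  frob_right f := θ.frob_right f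

theorem ofDressPairing_injective :
    Function.Injective (ofDressPairing : DressPairing M N P → OrbitPairing M N P) := by
  intro θ θ' h
  ext X : 2
  refine TensorProduct.ext' fun m n => P.ext_rMap fun K f => ?_
  rw [θ.res, θ'.res]
  exact LinearMap.congr_fun (congrFun (congrArg OrbitPairing.θ h) K) _

variable (M N P) in
/-- Dress pairings are determined by their restrictions to transitive `G`-sets. -/
def equivDressPairing : DressPairing M N P ≃ OrbitPairing M N P where
  toFun := ofDressPairing
  invFun := toDressPairing
  left_inv _ := ofDressPairing_injective (OrbitPairing.ext (funext (extend_orbit _)))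
  right_inv _ := OrbitPairing.ext (funext (extend_orbit _))

/-- A map of transitive `G`-sets is a conjugation followed by a projection, so a pairing on
transitive `G`-sets needs to be compatible with these maps only. -/
def ofCmapProj (θ : ∀ H : Subgroup G, M.val (orb R H) ⊗[R] N.val (orb R H) →ₗ[R] P.val (orb R H))
    (tMap_cmap : ∀ (g : G) (H : Subgroup G) (m : M.val (orb R H)) (n : N.val (orb R H)),
      P.tMap (cmap g H) (θ H (m ⊗ₜ n)) =
        θ (conj g H) (M.tMap (cmap g H) m ⊗ₜ N.tMap (cmap g H) n))
    (rMap_proj : ∀ {K H : Subgroup G} (h : K ≤ H) (m : M.val (orb R H)) (n : N.val (orb R H)),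
      P.rMap (proj h) (θ H (m ⊗ₜ n)) = θ K (M.rMap (proj h) m ⊗ₜ N.rMap (proj h) n))
    (frob_left : ∀ {K H : Subgroup G} (h : K ≤ H) (m : M.val (orb R K)) (n : N.val (orb R H)),
      P.tMap (proj h) (θ K (m ⊗ₜ N.rMap (proj h) n)) = θ H (M.tMap (proj h) m ⊗ₜ n))
    (frob_right : ∀ {K H : Subgroup G} (h : K ≤ H) (m : M.val (orb R H)) (n : N.val (orb R K)),
      P.tMap (proj h) (θ K (M.rMap (proj h) m ⊗ₜ n)) = θ H (m ⊗ₜ N.tMap (proj h) n)) :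
    OrbitPairing M N P where
  θ := θ
  res f m n := by
    obtain ⟨g, h, rfl⟩ := exists_eq_proj_comp_cmap f
    have hg := cmap_bijective g
    rw [← P.rMap_rMap, rMap_proj, ← M.rMap_rMap, ← N.rMap_rMap,
      ← M.tMap_rMap_self (hg _) (M.rMap (proj h) m), ← N.tMap_rMap_self (hg _) (N.rMap (proj h) n),
      ← tMap_cmap, P.rMap_tMap_self (hg _).1, M.rMap_tMap_self (hg _).1,
      N.rMap_tMap_self (hg _).1]
  frob_left f m n := by
    obtain ⟨g, h, rfl⟩ := exists_eq_proj_comp_cmap f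
    rw [← P.tMap_tMap, tMap_cmap, ← N.rMap_rMap, N.tMap_rMap_self (cmap_bijective g _),
      frob_left, M.tMap_tMap]
  frob_right f m n := by
    obtain ⟨g, h, rfl⟩ := exists_eq_proj_comp_cmap f
    rw [← P.tMap_tMap, tMap_cmap, ← M.rMap_rMap, M.tMap_rMap_self (cmap_bijective g _),
      frob_right, N.tMap_tMap]

end OrbitPairing

end OrbitPairing

/-! ### Identities between the operators on the grades of a module -/

section Grade

variable [Finite G] {M : Type*} [AddCommGroup M] [Module R M] [Module (MackeyAlgebra R G) M]
  [IsScalarTower R (MackeyAlgebra R G) M]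

theorem MackeyAlgebra.single_sum (H K : Subgroup G) {ι : Type*} (s : Finset ι)
    (f : ι → (orb R H ⟶ orb R K)) : single H K (∑ i ∈ s, f i) = ∑ i ∈ s, single H K (f i) :=
  map_sum (AddMonoidHom.mk' (single H K) (single_add H K)) f s

theorem MackeyAlgebra.single_mul_single_of_ne {H K L J : Subgroup G} (f : orb R H ⟶ orb R K)
    (g : orb R L ⟶ orb R J) (h : K ≠ L) : single H K f * single L J g = 0 := by
  ext A B
  rw [mul_app]
  refine Finset.sum_eq_zero fun C _ => ?_
  obtain rfl | hC := eq_or_ne C K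
  · rw [single_of_ne_left _ h, Limits.comp_zero]
  · rw [single_of_ne_right _ hC, Limits.zero_comp]

theorem gradeMul_gradeMul {H K L : Subgroup G} (f : orb R H ⟶ orb R K) (g : orb R K ⟶ orb R L)
    (x : grade R M L) : gradeMul M f (gradeMul M g x) = gradeMul M (f ≫ g) x :=
  Subtype.ext (by
    change MackeyAlgebra.single H K f • MackeyAlgebra.single K L g • (x : M) =
      MackeyAlgebra.single H L (f ≫ g) • (x : M)
    rw [← mul_smul, MackeyAlgebra.single_mul_single])

theorem gradeMul_sum {H K : Subgroup G} {ι : Type*} (s : Finset ι)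
    (f : ι → (orb R H ⟶ orb R K)) (x : grade R M K) :
    gradeMul M (∑ i ∈ s, f i) x = ∑ i ∈ s, gradeMul M (f i) x :=
  Subtype.ext (by
    rw [AddSubmonoidClass.coe_finsetSum]
    change MackeyAlgebra.single H K (∑ i ∈ s, f i) • (x : M) = _
    rw [MackeyAlgebra.single_sum, Finset.sum_smul]
    rfl)

theorem gradeInd_self {H : Subgroup G} (x : grade R M H) : gradeInd R M le_rfl x = x :=
  Subtype.ext (mem_grade.1 x.2)

theorem gradeRes_self {H : Subgroup G} (x : grade R M H) : gradeRes R M le_rfl x = x := by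
  have h : Omega.res (X := orb R H) (Y := orb R H) (proj le_rfl) =
      Omega.tr (X := orb R H) (Y := orb R H) (proj le_rfl) := by
    rw [proj_refl]
    rfl
  rw [gradeRes, h]
  exact gradeInd_self x

theorem gradeCon_gradeInd (g : G) {K H : Subgroup G} (h : K ≤ H) (x : grade R M K) :
    gradeCon R M g H (gradeInd R M h x) =
      gradeInd R M (conj_mono g h) (gradeCon R M g K x) := by
  rw [gradeCon, gradeInd, gradeMul_gradeMul, Omega.tr_comp_tr, gradeInd, gradeCon,
    gradeMul_gradeMul, Omega.tr_comp_tr, cmap_comp_proj]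

theorem gradeRes_gradeInd {J K H : Subgroup G} (hJ : J ≤ H) (hK : K ≤ H) (x : grade R M K) :
    gradeRes R M hJ (gradeInd R M hK x) =
      ∑ q : DCos J H K, gradeInd R M (conj_inf_le q.rep K J)
        (gradeCon R M q.rep _ (gradeRes R M inf_le_left x)) := by
  rw [gradeRes, gradeInd, gradeMul_gradeMul, Omega.res_proj_comp_tr_proj, gradeMul_sum]
  simp only [gradeInd, gradeCon, gradeRes, gradeMul_gradeMul]

theorem single_smul_of_mem_grade {H K L : Subgroup G} (f : orb R H ⟶ orb R K) (h : K ≠ L)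
    {x : M} (hx : x ∈ grade R M L) : MackeyAlgebra.single H K f • x = 0 := by
  rw [← mem_grade.1 hx, MackeyAlgebra.indEl, ← mul_smul,
    MackeyAlgebra.single_mul_single_of_ne _ _ h, zero_smul]

end Grade

/-! ### The operators on `A` -/

section Box

variable [Finite G] {M : Type*} [AddCommGroup M] [Module R M] [Module (MackeyAlgebra R G) M]
  [IsScalarTower R (MackeyAlgebra R G) M] {N : Type*} [AddCommGroup N] [Module R N]
  [Module (MackeyAlgebra R G) N] [IsScalarTower R (MackeyAlgebra R G) N]

namespace BoxGrade

@[elab_as_elim]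
theorem induction {motive : ∀ H : Subgroup G, BoxGrade R M N H → Prop}
    (zero : ∀ H, motive H 0) (add : ∀ H x y, motive H x → motive H y → motive H (x + y))
    (first : ∀ H m n, motive H (BoxGrade.first R M N H (m ⊗ₜ n)))
    (up : ∀ K H (h : K < H) x, motive K x → motive H (BoxGrade.up R M N h x))
    {H : Subgroup G} (x : BoxGrade R M N H) : motive H x := by
  classical
  have inc {H : Subgroup G} (c : SubChain H) (y : Tens R M N c.bot) :
      motive H (BoxGrade.inc R M N c y) := by
    induction c with
    | base H =>
      induction y using TensorProduct.induction_on with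
      | zero => exact (map_zero (BoxGrade.first R M N H)).symm ▸ zero H
      | tmul m n => exact first H m n
      | add y z hy hz => exact (map_add (BoxGrade.first R M N H) y z).symm ▸ add H _ _ hy hz
    | step h c ih => exact up_inc R M N h c y ▸ up _ _ h _ (ih y)
  exact DirectSum.induction_on x (zero H) (fun c y => inc c y) (add H)

theorem ind_self {H : Subgroup G} (x : BoxGrade R M N H) : ind R M N le_rfl x = x := by
  simp only [ind, dif_pos, LinearMap.id_apply]

theorem ind_of_lt {K H : Subgroup G} (h : K < H) (x : BoxGrade R M N K) :
    ind R M N h.le x = up R M N h x := by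
  simp only [ind, dif_neg h.ne]

theorem con_first (g : G) {H : Subgroup G} (m : grade R M H) (n : grade R N H) :
    con R M N g H (first R M N H (m ⊗ₜ n)) =
      first R M N (conj g H) (gradeCon R M g H m ⊗ₜ gradeCon R N g H n) :=
  lift_inc R M N _ (SubChain.base H) _

theorem con_up (g : G) {K H : Subgroup G} (h : K < H) (x : BoxGrade R M N K) :
    con R M N g H (up R M N h x) = up R M N (conj_lt g h) (con R M N g K x) := by
  refine LinearMap.congr_fun (f := con R M N g H ∘ₗ up R M N h)
    (g := up R M N (conj_lt g h) ∘ₗ con R M N g K) (hom_ext R M N fun c y => ?_) x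
  simp only [LinearMap.comp_apply, up_inc, con, lift_inc]
  exact lift_inc R M N _ (SubChain.step h c) y

theorem res_first {J H : Subgroup G} (h : J ≤ H) (m : grade R M H) (n : grade R N H) :
    res R M N h (first R M N H (m ⊗ₜ n)) =
      first R M N J (gradeRes R M h m ⊗ₜ gradeRes R N h n) :=
  lift_inc R M N _ (SubChain.base H) _

theorem res_up {J K H : Subgroup G} (hJ : J ≤ H) (hK : K < H) (x : BoxGrade R M N K) :
    res R M N hJ (up R M N hK x) =
      ∑ q : DCos J H K, ind R M N (conj_inf_le q.rep K J)
        (con R M N q.rep _ (res R M N inf_le_left x)) := by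
  refine (LinearMap.congr_fun (f := res R M N hJ ∘ₗ up R M N hK)
    (g := ∑ q : DCos J H K, ind R M N (conj_inf_le q.rep K J) ∘ₗ con R M N q.rep _ ∘ₗ
      res R M N inf_le_left) (hom_ext R M N fun c y => ?_) x).trans
    (by simp only [LinearMap.sum_apply, LinearMap.comp_apply])
  simp only [LinearMap.sum_apply, LinearMap.comp_apply, up_inc, res, lift_inc]
  exact (lift_inc R M N _ (SubChain.step hK c) y).trans (LinearMap.sum_apply ..)

end BoxGrade

namespace BoxSum

theorem pr_inc {H : Subgroup G} (x : BoxGrade R M N H) : pr R M N H (inc R M N H x) = x := by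
  classical
  exact Pi.single_eq_same (M := fun H : Subgroup G => BoxGrade R M N H) H x

theorem pr_inc_of_ne {K H : Subgroup G} (h : K ≠ H) (x : BoxGrade R M N H) :
    pr R M N K (inc R M N H x) = 0 := by
  classical
  exact Pi.single_eq_of_ne (M := fun H : Subgroup G => BoxGrade R M N H) h x

theorem op_ind_inc {K H : Subgroup G} (h : K ≤ H) (x : BoxGrade R M N K) :
    op R M N (.ind K H h) (inc R M N K x) = inc R M N H (BoxGrade.ind R M N h x) := by
  rw [op, LinearMap.comp_apply, LinearMap.comp_apply, pr_inc]

theorem op_con_inc (g : G) {H : Subgroup G} (x : BoxGrade R M N H) :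
    op R M N (.con g H) (inc R M N H x) = inc R M N (conj g H) (BoxGrade.con R M N g H x) := by
  rw [op, LinearMap.comp_apply, LinearMap.comp_apply, pr_inc]

theorem op_res_inc {K H : Subgroup G} (h : K ≤ H) (x : BoxGrade R M N H) :
    op R M N (.res K H h) (inc R M N H x) = inc R M N K (BoxGrade.res R M N h x) := by
  rw [op, LinearMap.comp_apply, LinearMap.comp_apply, pr_inc]

theorem hom_ext {Q : Type*} [AddCommMonoid Q] [Module R Q] {f f' : BoxSum (G := G) R M N →ₗ[R] Q}
    (h : ∀ H x, f (inc R M N H x) = f' (inc R M N H x)) : f = f' := by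
  classical
  exact LinearMap.pi_ext' fun H => LinearMap.ext (h H)

end BoxSum

/-! ### Maps out of the box product -/

section Lift

variable {Q : Type*} [AddCommGroup Q] [Module (MackeyAlgebra R G) Q]

theorem Box.hom_mk_op (β : Box (G := G) R M N →ₗ[MackeyAlgebra R G] Q) (s : Gen G)
    (x : BoxSum (G := G) R M N) :
    β (Box.mk R M N (BoxSum.op R M N s x)) = s.elem R • β (Box.mk R M N x) := by
  rw [← Box.elem_smul_mk, map_smul]

theorem Box.mk_eq_zero {x : BoxSum (G := G) R M N} (hx : x ∈ BoxSum.FR R M N) :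
    Box.mk R M N x = 0 :=
  (Submodule.Quotient.mk_eq_zero _).2 (Submodule.mem_sup_left hx)

variable [Module R Q] [IsScalarTower R (MackeyAlgebra R G) Q]

theorem BoxSum.hom_act {f : BoxSum (G := G) R M N →ₗ[R] Q}
    (hf : ∀ (s : Gen G) x, f (BoxSum.op R M N s x) = s.elem R • f x)
    (p : FreeAlgebra R (Gen G)) (x : BoxSum (G := G) R M N) :
    f (BoxSum.act R M N p x) = evalGen R G p • f x := by
  induction p using FreeAlgebra.induction generalizing x with
  | grade0 r =>
    simp only [AlgHom.commutes, Module.algebraMap_end_apply, map_smul, algebraMap_smul]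
  | grade1 s => rw [BoxSum.act_ι, evalGen_ι, hf]
  | mul a b ha hb => simp only [map_mul, Module.End.mul_apply, ha, hb, mul_smul]
  | add a b ha hb => simp only [map_add, LinearMap.add_apply, ha, hb, add_smul]

theorem BoxSum.ker_le_ker {f : BoxSum (G := G) R M N →ₗ[R] Q}
    (hf : ∀ (s : Gen G) x, f (BoxSum.op R M N s x) = s.elem R • f x)
    (hFR : ∀ x ∈ BoxSum.FR (G := G) R M N, f x = 0) :
    BoxSum.ker R M N ≤ LinearMap.ker f := by
  refine sup_le hFR (Submodule.span_le.2 ?_)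
  rintro _ ⟨p, x, hp, rfl⟩
  change f _ = 0
  rw [BoxSum.hom_act hf, hp, zero_smul]

/-- The map out of the box product induced by a map out of `A`. -/
def Box.lift (f : BoxSum (G := G) R M N →ₗ[R] Q)
    (hf : ∀ (s : Gen G) x, f (BoxSum.op R M N s x) = s.elem R • f x)
    (hFR : ∀ x ∈ BoxSum.FR (G := G) R M N, f x = 0) :
    Box (G := G) R M N →ₗ[MackeyAlgebra R G] Q where
  toFun := (BoxSum.ker R M N).liftQ f (BoxSum.ker_le_ker hf hFR)
  map_add' := map_add _
  map_smul' a y := by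
    obtain ⟨p, rfl⟩ := evalGen_surjective a
    obtain ⟨x, rfl⟩ := Box.mk_surjective R M N y
    rw [Box.evalGen_smul_mk]
    exact BoxSum.hom_act hf p x

theorem Box.bijOn_comp_mk :
    Set.BijOn (fun β : Box (G := G) R M N →ₗ[MackeyAlgebra R G] Q =>
        β.restrictScalars R ∘ₗ Box.mk R M N) Set.univ
      {f : BoxSum (G := G) R M N →ₗ[R] Q |
        (∀ (s : Gen G) (x : BoxSum (G := G) R M N),
          f (BoxSum.op R M N s x) = s.elem R • f x) ∧
        ∀ x ∈ BoxSum.FR (G := G) R M N, f x = 0} := by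
  refine ⟨fun β _ => ⟨fun s x => Box.hom_mk_op β s x, fun x hx => ?_⟩, fun β _ γ _ h => ?_,
    fun f hf => ⟨Box.lift f hf.1 hf.2, trivial, rfl⟩⟩
  · exact (congrArg β (Box.mk_eq_zero hx)).trans (map_zero β)
  · ext y
    obtain ⟨x, rfl⟩ := Box.mk_surjective R M N y
    exact LinearMap.congr_fun h x

theorem Box.hom_ext {β γ : Box (G := G) R M N →ₗ[MackeyAlgebra R G] Q}
    (h : ∀ (H : Subgroup G) (m : grade R M H) (n : grade R N H),
      β (Box.mk R M N (BoxSum.inc R M N H (BoxGrade.first R M N H (m ⊗ₜ n)))) =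
        γ (Box.mk R M N (BoxSum.inc R M N H (BoxGrade.first R M N H (m ⊗ₜ n))))) : β = γ := by
  have on_grade (H : Subgroup G) (x : BoxGrade R M N H) :
      β (Box.mk R M N (BoxSum.inc R M N H x)) = γ (Box.mk R M N (BoxSum.inc R M N H x)) := by
    induction x using BoxGrade.induction with
    | zero => simp only [map_zero]
    | add H x y hx hy => simp only [map_add, hx, hy]
    | first H m n => exact h H m n
    | up K H hlt x ih =>
      rw [← BoxGrade.ind_of_lt, ← BoxSum.op_ind_inc, hom_mk_op, hom_mk_op, ih]
  exact Box.bijOn_comp_mk.injOn (Set.mem_univ β) (Set.mem_univ γ) (BoxSum.hom_ext on_grade)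

end Lift

end Box

/-! ### Dress pairings of modules -/

section BoxPairing

variable [Finite G]

variable (R) in
/-- The analogue of a Dress pairing for `μ_R(G)`-modules: maps on the grades which are compatible
with `R^H_K` and `C_{g,H}` and satisfy Frobenius reciprocity for `I^H_K`. -/
@[ext] structure BoxPairing (M N Q : Type*)
    [AddCommGroup M] [Module R M] [Module (MackeyAlgebra R G) M]
    [IsScalarTower R (MackeyAlgebra R G) M]
    [AddCommGroup N] [Module R N] [Module (MackeyAlgebra R G) N]
    [IsScalarTower R (MackeyAlgebra R G) N]
    [AddCommGroup Q] [Module R Q] [Module (MackeyAlgebra R G) Q]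
    [IsScalarTower R (MackeyAlgebra R G) Q] where
  /-- the maps `I^H_H M ⊗ I^H_H N → I^H_H Q` -/
  θ : ∀ H : Subgroup G, Tens R M N H →ₗ[R] grade R Q H
  con : ∀ (g : G) (H : Subgroup G) (m : grade R M H) (n : grade R N H),
    gradeCon R Q g H (θ H (m ⊗ₜ n)) = θ (conj g H) (gradeCon R M g H m ⊗ₜ gradeCon R N g H n)
  res : ∀ {K H : Subgroup G} (h : K ≤ H) (m : grade R M H) (n : grade R N H),
    gradeRes R Q h (θ H (m ⊗ₜ n)) = θ K (gradeRes R M h m ⊗ₜ gradeRes R N h n)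
  frob_left : ∀ {K H : Subgroup G} (h : K ≤ H) (m : grade R M K) (n : grade R N H),
    gradeInd R Q h (θ K (m ⊗ₜ gradeRes R N h n)) = θ H (gradeInd R M h m ⊗ₜ n)
  frob_right : ∀ {K H : Subgroup G} (h : K ≤ H) (m : grade R M H) (n : grade R N K),
    gradeInd R Q h (θ K (gradeRes R M h m ⊗ₜ n)) = θ H (m ⊗ₜ gradeInd R N h n)

variable {M N Q : Type*} [AddCommGroup M] [Module R M] [Module (MackeyAlgebra R G) M]
  [IsScalarTower R (MackeyAlgebra R G) M] [AddCommGroup N] [Module R N]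
  [Module (MackeyAlgebra R G) N] [IsScalarTower R (MackeyAlgebra R G) N] [AddCommGroup Q]
  [Module R Q] [Module (MackeyAlgebra R G) Q] [IsScalarTower R (MackeyAlgebra R G) Q]

namespace BoxPairing

section OnSum

variable (θ : BoxPairing (G := G) R M N Q)

/-- The extension of a pairing along transfers to the summand of `A_H` that belongs to a chain. -/
def onChain : {H : Subgroup G} → (c : SubChain H) → (Tens R M N c.bot →ₗ[R] grade R Q H)
  | _, .base H => θ.θ H
  | _, .step h c => gradeInd R Q h.le ∘ₗ onChain c

/-- The extension of a pairing along transfers to `A_H`. -/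
def onGrade (H : Subgroup G) : BoxGrade R M N H →ₗ[R] grade R Q H :=
  BoxGrade.lift R M N fun c => θ.onChain c

theorem onGrade_first {H : Subgroup G} (t : Tens R M N H) :
    θ.onGrade H (BoxGrade.first R M N H t) = θ.θ H t :=
  BoxGrade.lift_inc R M N _ (SubChain.base H) t

theorem onGrade_up {K H : Subgroup G} (h : K < H) (x : BoxGrade R M N K) :
    θ.onGrade H (BoxGrade.up R M N h x) = gradeInd R Q h.le (θ.onGrade K x) := by
  refine LinearMap.congr_fun (f := θ.onGrade H ∘ₗ BoxGrade.up R M N h)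
    (g := gradeInd R Q h.le ∘ₗ θ.onGrade K) (BoxGrade.hom_ext R M N fun c y => ?_) x
  simp only [LinearMap.comp_apply, BoxGrade.up_inc, onGrade, BoxGrade.lift_inc]
  exact BoxGrade.lift_inc R M N _ (SubChain.step h c) y

theorem onGrade_ind {K H : Subgroup G} (h : K ≤ H) (x : BoxGrade R M N K) :
    θ.onGrade H (BoxGrade.ind R M N h x) = gradeInd R Q h (θ.onGrade K x) := by
  obtain rfl | hlt := h.eq_or_lt
  · rw [BoxGrade.ind_self, gradeInd_self]
  · rw [BoxGrade.ind_of_lt hlt, onGrade_up]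

theorem onGrade_con (g : G) {H : Subgroup G} (x : BoxGrade R M N H) :
    θ.onGrade (conj g H) (BoxGrade.con R M N g H x) = gradeCon R Q g H (θ.onGrade H x) := by
  induction x using BoxGrade.induction with
  | zero => simp only [map_zero]
  | add H x y hx hy => simp only [map_add, hx, hy]
  | first H m n => rw [BoxGrade.con_first, onGrade_first, onGrade_first, θ.con]
  | up K H h x ih => rw [BoxGrade.con_up, onGrade_up, onGrade_up, ih, gradeCon_gradeInd]

/-- On a transfer, both sides are given by the Mackey formula. -/
theorem onGrade_res {J H : Subgroup G} (h : J ≤ H) (x : BoxGrade R M N H) :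
    θ.onGrade J (BoxGrade.res R M N h x) = gradeRes R Q h (θ.onGrade H x) := by
  induction x using BoxGrade.induction generalizing J with
  | zero => simp only [map_zero]
  | add H x y hx hy => simp only [map_add, hx, hy]
  | first H m n => rw [BoxGrade.res_first, onGrade_first, onGrade_first, θ.res]
  | up K H hK x ih =>
    rw [BoxGrade.res_up, onGrade_up, gradeRes_gradeInd, map_sum]
    simp only [onGrade_ind, onGrade_con, ih]

/-- The extension of a pairing along transfers to `A`. -/
def onSum : BoxSum (G := G) R M N →ₗ[R] Q :=
  ∑ H : Subgroup G, (grade R Q H).subtype ∘ₗ θ.onGrade H ∘ₗ BoxSum.pr R M N H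

theorem onSum_apply (x : BoxSum (G := G) R M N) :
    θ.onSum x = ∑ H : Subgroup G, (θ.onGrade H (BoxSum.pr R M N H x) : Q) := by
  simp only [onSum, LinearMap.sum_apply, LinearMap.comp_apply, Submodule.subtype_apply]

theorem onSum_inc {H : Subgroup G} (x : BoxGrade R M N H) :
    θ.onSum (BoxSum.inc R M N H x) = θ.onGrade H x := by
  rw [onSum_apply, Finset.sum_eq_single H, BoxSum.pr_inc]
  · intro K _ hK
    rw [BoxSum.pr_inc_of_ne hK, map_zero, ZeroMemClass.coe_zero]
  · exact fun h => (h (Finset.mem_univ H)).elim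

theorem single_smul_onSum {H K : Subgroup G} (f : orb R H ⟶ orb R K)
    (x : BoxSum (G := G) R M N) :
    MackeyAlgebra.single H K f • θ.onSum x =
      gradeMul Q f (θ.onGrade K (BoxSum.pr R M N K x)) := by
  rw [onSum_apply, Finset.smul_sum, Finset.sum_eq_single K]
  · rfl
  · exact fun L _ hL => single_smul_of_mem_grade f hL.symm (Subtype.prop _)
  · exact fun h => (h (Finset.mem_univ K)).elim

theorem onSum_op (s : Gen G) (x : BoxSum (G := G) R M N) :
    θ.onSum (BoxSum.op R M N s x) = s.elem R • θ.onSum x := by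
  cases s with
  | res K H h =>
    exact (θ.onSum_inc _).trans
      ((congrArg _ (θ.onGrade_res h _)).trans (θ.single_smul_onSum _ x).symm)
  | ind K H h =>
    exact (θ.onSum_inc _).trans
      ((congrArg _ (θ.onGrade_ind h _)).trans (θ.single_smul_onSum _ x).symm)
  | con g H =>
    exact (θ.onSum_inc _).trans
      ((congrArg _ (θ.onGrade_con g _)).trans (θ.single_smul_onSum _ x).symm)

theorem onSum_isFrob {x : BoxSum (G := G) R M N} (hx : BoxSum.IsFrob R M N x) :
    θ.onSum x = 0 := by
  cases hx with
  | right h a b =>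
    rw [map_sub, BoxSum.op_ind_inc, onSum_inc, onSum_inc, onGrade_ind, onGrade_first,
      onGrade_first, θ.frob_right, sub_self]
  | left h c d =>
    rw [map_sub, BoxSum.op_ind_inc, onSum_inc, onSum_inc, onGrade_ind, onGrade_first,
      onGrade_first, θ.frob_left, sub_self]

theorem onSum_FR (x : BoxSum (G := G) R M N) (hx : x ∈ BoxSum.FR R M N) : θ.onSum x = 0 := by
  have le_ker : BoxSum.FR R M N ≤ LinearMap.ker θ.onSum :=
    sInf_le ⟨fun y hy => θ.onSum_isFrob hy, fun s y hy => by
      rw [LinearMap.mem_ker, onSum_op, LinearMap.mem_ker.1 hy, smul_zero]⟩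
  exact le_ker hx

/-- The module map out of the box product given by a pairing. -/
def lift : Box (G := G) R M N →ₗ[MackeyAlgebra R G] Q :=
  Box.lift θ.onSum θ.onSum_op θ.onSum_FR

theorem lift_mk_inc {H : Subgroup G} (x : BoxGrade R M N H) :
    θ.lift (Box.mk R M N (BoxSum.inc R M N H x)) = θ.onGrade H x :=
  θ.onSum_inc x

end OnSum

variable (M N) in
/-- The first summands of the grades of `A`, as maps to the grades of the box product. -/
def univMap (H : Subgroup G) : Tens R M N H →ₗ[R] grade R (Box (G := G) R M N) H :=
  (Box.mk R M N ∘ₗ BoxSum.inc R M N H ∘ₗ BoxGrade.first R M N H).codRestrict _ fun t =>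
    mem_grade.2 ((Box.elem_smul_mk R M N (.ind H H le_rfl) _).trans (by
      rw [LinearMap.comp_apply, BoxSum.op_ind_inc, BoxGrade.ind_self]
      rfl))

theorem coe_univMap {H : Subgroup G} (t : Tens R M N H) :
    (univMap M N H t : Box R M N) =
      Box.mk R M N (BoxSum.inc R M N H (BoxGrade.first R M N H t)) := rfl

theorem gradeInd_univMap_left {K H : Subgroup G} (h : K ≤ H) (m : grade R M K)
    (n : grade R N H) :
    gradeInd R _ h (univMap M N K (m ⊗ₜ gradeRes R N h n)) =
      univMap M N H (gradeInd R M h m ⊗ₜ n) := by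
  obtain rfl | hlt := h.eq_or_lt
  · rw [gradeInd_self, gradeInd_self, gradeRes_self]
  · have frob := Box.mk_eq_zero (BoxSum.frob_mem_FR (.left hlt m n))
    rw [map_sub, sub_eq_zero, ← Box.elem_smul_mk] at frob
    exact Subtype.ext frob.symm

theorem gradeInd_univMap_right {K H : Subgroup G} (h : K ≤ H) (m : grade R M H)
    (n : grade R N K) :
    gradeInd R _ h (univMap M N K (gradeRes R M h m ⊗ₜ n)) =
      univMap M N H (m ⊗ₜ gradeInd R N h n) := by
  obtain rfl | hlt := h.eq_or_lt
  · rw [gradeInd_self, gradeInd_self, gradeRes_self]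
  · have frob := Box.mk_eq_zero (BoxSum.frob_mem_FR (.right hlt m n))
    rw [map_sub, sub_eq_zero, ← Box.elem_smul_mk] at frob
    exact Subtype.ext frob.symm

variable (M N) in
/-- The universal pairing of two modules, with values in their box product. -/
def univ : BoxPairing (G := G) R M N (Box (G := G) R M N) where
  θ := univMap M N
  con g H m n := Subtype.ext ((Box.elem_smul_mk R M N (.con g H) _).trans (by
    rw [LinearMap.comp_apply, BoxSum.op_con_inc, BoxGrade.con_first, coe_univMap]))
  res {K H} h m n := Subtype.ext ((Box.elem_smul_mk R M N (.res K H h) _).trans (by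
    rw [LinearMap.comp_apply, BoxSum.op_res_inc, BoxGrade.res_first, coe_univMap]))
  frob_left := gradeInd_univMap_left
  frob_right := gradeInd_univMap_right

/-- The composition of a pairing with a module map. -/
def comp {Q' : Type*} [AddCommGroup Q'] [Module R Q'] [Module (MackeyAlgebra R G) Q']
    [IsScalarTower R (MackeyAlgebra R G) Q'] (β : Q →ₗ[MackeyAlgebra R G] Q')
    (θ : BoxPairing (G := G) R M N Q) : BoxPairing (G := G) R M N Q' where
  θ H := gradeMap β H ∘ₗ θ.θ H
  con g H m n := (gradeMap_gradeMul β _ _).symm.trans (congrArg _ (θ.con g H m n))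
  res h m n := (gradeMap_gradeMul β _ _).symm.trans (congrArg _ (θ.res h m n))
  frob_left h m n := (gradeMap_gradeMul β _ _).symm.trans (congrArg _ (θ.frob_left h m n))
  frob_right h m n := (gradeMap_gradeMul β _ _).symm.trans (congrArg _ (θ.frob_right h m n))

variable (R M N Q) in
/-- The universal property of the box product. -/
def equivBoxHom : BoxPairing (G := G) R M N Q ≃ (Box (G := G) R M N →ₗ[MackeyAlgebra R G] Q) where
  toFun := lift
  invFun β := (univ M N).comp β
  left_inv θ := BoxPairing.ext (funext fun _ => LinearMap.ext fun t => Subtype.ext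
    ((θ.lift_mk_inc _).trans (congrArg _ (θ.onGrade_first t))))
  right_inv _ := Box.hom_ext fun _ _ _ =>
    (lift_mk_inc _ _).trans (congrArg _ (onGrade_first _ _))

end BoxPairing

end BoxPairing

/-! ### The grades of `Φ M` -/

section Phi

variable [Finite G]

theorem Phi.gradeMul_gr (M : MackeyFunctor.{u, v, w} R G) {H K : Subgroup G}
    (f : orb R H ⟶ orb R K) (m : M.val (orb R K)) :
    gradeMul (Phi M) f (Phi.gr M K m) = Phi.gr M H (M.ap f m) :=
  Subtype.ext ((Phi.single_smul M f _).trans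
    (congrArg (fun x => Phi.inc M H (M.ap f x)) (Phi.inc_same M K m)))

theorem Phi.gradeCon_gr (M : MackeyFunctor.{u, v, w} R G) (g : G) {H : Subgroup G}
    (m : M.val (orb R H)) :
    gradeCon R (Phi M) g H (Phi.gr M H m) = Phi.gr M (conj g H) (M.tMap (cmap g H) m) :=
  Phi.gradeMul_gr M _ m

theorem Phi.gradeRes_gr (M : MackeyFunctor.{u, v, w} R G) {K H : Subgroup G} (h : K ≤ H)
    (m : M.val (orb R H)) :
    gradeRes R (Phi M) h (Phi.gr M H m) = Phi.gr M K (M.rMap (proj h) m) :=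
  Phi.gradeMul_gr M _ m

theorem Phi.gradeInd_gr (M : MackeyFunctor.{u, v, w} R G) {K H : Subgroup G} (h : K ≤ H)
    (m : M.val (orb R K)) :
    gradeInd R (Phi M) h (Phi.gr M K m) = Phi.gr M H (M.tMap (proj h) m) :=
  Phi.gradeMul_gr M _ m

variable (M N P : MackeyFunctor.{u, v, w} R G)

/-- Pairings on `G/H` as pairings on the grades `H`, through the identifications
`M(G/H) = I^H_H Φ M`. -/
def Phi.pairingGr (H : Subgroup G) :
    (M.val (orb R H) ⊗[R] N.val (orb R H) →ₗ[R] P.val (orb R H)) ≃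
      (Tens R (Phi M) (Phi N) H →ₗ[R] grade R (Phi P) H) :=
  ((TensorProduct.congr (Phi.gr M H) (Phi.gr N H)).arrowCongr (Phi.gr P H)).toEquiv

variable {M N P}

theorem Phi.pairingGr_tmul {H : Subgroup G}
    (θ : M.val (orb R H) ⊗[R] N.val (orb R H) →ₗ[R] P.val (orb R H)) (m : M.val (orb R H))
    (n : N.val (orb R H)) :
    Phi.pairingGr M N P H θ (Phi.gr M H m ⊗ₜ Phi.gr N H n) = Phi.gr P H (θ (m ⊗ₜ n)) := by
  refine congrArg (fun t => Phi.gr P H (θ t)) ?_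
  exact (TensorProduct.congr (Phi.gr M H) (Phi.gr N H)).symm_apply_apply (m ⊗ₜ n)

theorem Phi.gr_pairingGr_symm_tmul {H : Subgroup G}
    (θ : Tens R (Phi M) (Phi N) H →ₗ[R] grade R (Phi P) H) (m : M.val (orb R H))
    (n : N.val (orb R H)) :
    Phi.gr P H ((Phi.pairingGr M N P H).symm θ (m ⊗ₜ n)) = θ (Phi.gr M H m ⊗ₜ Phi.gr N H n) := by
  rw [← Phi.pairingGr_tmul, Equiv.apply_symm_apply]

theorem Phi.forall_gr {H K : Subgroup G} {p : grade R (Phi M) H → grade R (Phi N) K → Prop} :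
    (∀ m n, p m n) ↔ ∀ m n, p (Phi.gr M H m) (Phi.gr N K n) :=
  (Phi.gr M H).surjective.forall.trans (forall_congr' fun _ => (Phi.gr N K).surjective.forall)

/-- The pairing of modules given by a pairing of Mackey functors on transitive `G`-sets. -/
def OrbitPairing.toBoxPairing (θ : OrbitPairing M N P) :
    BoxPairing (G := G) R (Phi M) (Phi N) (Phi P) where
  θ H := Phi.pairingGr M N P H (θ.θ H)
  con g H := Phi.forall_gr.2 fun m n => by
    simp only [Phi.pairingGr_tmul, Phi.gradeCon_gr, θ.tMap_tmul (cmap_bijective g H).1]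
  res h := Phi.forall_gr.2 fun m n => by
    simp only [Phi.pairingGr_tmul, Phi.gradeRes_gr, θ.res]
  frob_left h := Phi.forall_gr.2 fun m n => by
    simp only [Phi.pairingGr_tmul, Phi.gradeRes_gr, Phi.gradeInd_gr, θ.frob_left]
  frob_right h := Phi.forall_gr.2 fun m n => by
    simp only [Phi.pairingGr_tmul, Phi.gradeRes_gr, Phi.gradeInd_gr, θ.frob_right]

/-- The pairing of Mackey functors on transitive `G`-sets given by a pairing of modules. -/
def OrbitPairing.ofBoxPairing (β : BoxPairing (G := G) R (Phi M) (Phi N) (Phi P)) :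
    OrbitPairing M N P :=
  OrbitPairing.ofCmapProj (fun H => (Phi.pairingGr M N P H).symm (β.θ H))
    (fun g H m n => (Phi.gr P _).injective <| by
      simp only [← Phi.gradeCon_gr, Phi.gr_pairingGr_symm_tmul, β.con])
    (fun h m n => (Phi.gr P _).injective <| by
      simp only [← Phi.gradeRes_gr, Phi.gr_pairingGr_symm_tmul, β.res])
    (fun h m n => (Phi.gr P _).injective <| by
      simp only [← Phi.gradeInd_gr, ← Phi.gradeRes_gr, Phi.gr_pairingGr_symm_tmul, β.frob_left])
    (fun h m n => (Phi.gr P _).injective <| by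
      simp only [← Phi.gradeInd_gr, ← Phi.gradeRes_gr, Phi.gr_pairingGr_symm_tmul, β.frob_right])

variable (M N P) in
/-- A pairing on transitive `G`-sets is the same as a pairing of modules. -/
def OrbitPairing.equivBoxPairing :
    OrbitPairing M N P ≃ BoxPairing (G := G) R (Phi M) (Phi N) (Phi P) where
  toFun := toBoxPairing
  invFun := ofBoxPairing
  left_inv _ := OrbitPairing.ext (funext fun H => (Phi.pairingGr M N P H).symm_apply_apply _)
  right_inv _ := BoxPairing.ext (funext fun H => (Phi.pairingGr M N P H).apply_symm_apply _)

variable (M N P) in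
/-- The bijection between Dress pairings and module maps out of the box product. -/
def DressPairing.equivBoxHom :
    DressPairing M N P ≃ (Box (G := G) R (Phi M) (Phi N) →ₗ[MackeyAlgebra R G] Phi P) :=
  (OrbitPairing.equivDressPairing M N P).trans
    ((OrbitPairing.equivBoxPairing M N P).trans (BoxPairing.equivBoxHom R _ _ _))

theorem DressPairing.equivBoxHom_firstTensor (θ : DressPairing M N P) (H : Subgroup G)
    (m : M.val (orb R H)) (n : N.val (orb R H)) :
    equivBoxHom M N P θ (firstTensor M N H m n) = Phi.inc P H (θ.θ (orb R H) (m ⊗ₜ n)) := by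
  refine (BoxPairing.lift_mk_inc _ _).trans ?_
  rw [BoxPairing.onGrade_first]
  exact congrArg Subtype.val (Phi.pairingGr_tmul _ m n)

theorem Box.phi_hom_ext {β γ : Box (G := G) R (Phi M) (Phi N) →ₗ[MackeyAlgebra R G] Phi P}
    (h : ∀ (H : Subgroup G) (m : M.val (orb R H)) (n : N.val (orb R H)),
      β (firstTensor M N H m n) = γ (firstTensor M N H m n)) : β = γ :=
  Box.hom_ext fun H => Phi.forall_gr.2 (h H)

theorem Phi.map_inc (a : M.Hom N) (H : Subgroup G) (m : M.val (orb R H)) :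
    Phi.map a (Phi.inc M H m) = Phi.inc N H (a.at (orb R H) m) := by
  refine funext fun K => ?_
  change a.at (orb R K) (Phi.inc M H m K) = Phi.inc N H (a.at (orb R H) m) K
  obtain rfl | h := eq_or_ne K H
  · rw [Phi.inc_same, Phi.inc_same]
  · rw [Phi.inc_ne _ h, Phi.inc_ne _ h, map_zero]

theorem Phi.gradeMap_gr (a : M.Hom N) (H : Subgroup G) (m : M.val (orb R H)) :
    gradeMap (Phi.map a) H (Phi.gr M H m) = Phi.gr N H (a.at (orb R H) m) :=
  Subtype.ext (Phi.map_inc a H m)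

theorem Box.map_firstTensor {M' N' : MackeyFunctor.{u, v, w} R G} (a : M'.Hom M)
    (b : N'.Hom N) (H : Subgroup G) (m : M'.val (orb R H)) (n : N'.val (orb R H)) :
    Box.map (Phi.map a) (Phi.map b) (firstTensor M' N' H m n) =
      firstTensor M N H (a.at (orb R H) m) (b.at (orb R H) n) := by
  refine (Box.mapAux_mk (Phi.map a) (Phi.map b) _).trans ?_
  rw [BoxSum.map_inc, BoxGrade.map_first, tensMap, TensorProduct.map_tmul, Phi.gradeMap_gr,
    Phi.gradeMap_gr, firstTensor]

theorem DressPairing.equivBoxHom_map {M' N' P' : MackeyFunctor.{u, v, w} R G} (a : M'.Hom M)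
    (b : N'.Hom N) (c : P.Hom P') (θ : DressPairing M N P) :
    equivBoxHom M' N' P' (θ.map a b c) =
      Phi.map c ∘ₗ equivBoxHom M N P θ ∘ₗ Box.map (Phi.map a) (Phi.map b) :=
  Box.phi_hom_ext fun H m n => by
    rw [LinearMap.comp_apply, LinearMap.comp_apply, Box.map_firstTensor, equivBoxHom_firstTensor,
      equivBoxHom_firstTensor, Phi.map_inc]
    rfl

end Phi

end MackeyBox

end

theorem mainTheorem2 {G : Type u} [Group G] [Finite G] {R : Type w} [CommRing R] :
    ∃ e : ∀ M N P : MackeyFunctor.{u, v, w} R G,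
        DressPairing M N P ≃ (Box (G := G) R (Phi M) (Phi N) →ₗ[MackeyAlgebra R G] Phi P),
      -- the bijection is natural in `M`, `N` and `P`
      (∀ (M M' N N' P P' : MackeyFunctor.{u, v, w} R G) (a : M'.Hom M) (b : N'.Hom N)
        (c : P.Hom P') (θ : DressPairing M N P),
        e M' N' P' (θ.map a b c) =
          Phi.map c ∘ₗ e M N P θ ∘ₗ Box.map (Phi.map a) (Phi.map b)) ∧
      -- a module map restricts to a pairing on the first summand of each grade
      (∀ (M N P : MackeyFunctor.{u, v, w} R G)
        (β : Box (G := G) R (Phi M) (Phi N) →ₗ[MackeyAlgebra R G] Phi P) (H : Subgroup G)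
        (m : M.val (orb R H)) (n : N.val (orb R H)),
        Phi.inc P H (((e M N P).symm β).θ (orb R H) (m ⊗ₜ[R] n)) = β (firstTensor M N H m n)) ∧
      -- a pairing extends to a module map, grade by grade
      (∀ (M N P : MackeyFunctor.{u, v, w} R G) (θ : DressPairing M N P) (H : Subgroup G),
        (∀ (m : M.val (orb R H)) (n : N.val (orb R H)),
          e M N P θ (firstTensor M N H m n) = Phi.inc P H (θ.θ (orb R H) (m ⊗ₜ[R] n))) ∧
        ∀ (K : Subgroup G) (h : K < H) (x : BoxGrade R (Phi M) (Phi N) K),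
          e M N P θ (Box.mk R _ _ (BoxSum.inc R _ _ H (BoxGrade.up R _ _ h x))) =
            (MackeyAlgebra.indEl h.le : MackeyAlgebra R G) •
              e M N P θ (Box.mk R _ _ (BoxSum.inc R _ _ K x))) ∧
      -- module maps out of the box product are the maps out of `A = ⨁ A_H` which commute with
      -- all `R^H_K`, `I^H_K`, `C_{g,H}` and kill the Frobenius reciprocity submodule
      (∀ M N P : MackeyFunctor.{u, v, w} R G,
        Set.BijOn
          (fun β : Box (G := G) R (Phi M) (Phi N) →ₗ[MackeyAlgebra R G] Phi P =>
            β.restrictScalars R ∘ₗ Box.mk R (Phi M) (Phi N))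
          Set.univ
          {f : BoxSum (G := G) R (Phi M) (Phi N) →ₗ[R] Phi P |
            (∀ (s : Gen G) (x : BoxSum (G := G) R (Phi M) (Phi N)),
              f (BoxSum.op R (Phi M) (Phi N) s x) = s.elem R • f x) ∧
            ∀ x ∈ BoxSum.FR (G := G) R (Phi M) (Phi N), f x = 0}) := by
  refine ⟨DressPairing.equivBoxHom, fun M M' N N' P P' a b c θ => θ.equivBoxHom_map a b c,
    fun M N P β H m n => ?_, fun M N P θ H => ⟨θ.equivBoxHom_firstTensor H, fun K h x => ?_⟩,
    fun M N P => Box.bijOn_comp_mk⟩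
  · rw [← DressPairing.equivBoxHom_firstTensor, Equiv.apply_symm_apply]
  · rw [← BoxGrade.ind_of_lt, ← BoxSum.op_ind_inc]
    exact Box.hom_mk_op _ (.ind K H h.le) _
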